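/- **Setting.** A system $(A,C)$ with $A\in\mathbb R^{n\times n}$, $C\in\mathbb R^{p\times n}$ is $\dot x(t)=Ax(t)$, $w(t)=Cx(t)$, $t\ge 0$. Two systems $(A_1,C_1)$ and $(A_2,C_2)$ with the same state dimension and the same $p$ are *topologically equivalent* if there is a homeomorphism $H$ of $\mathbb R^n$ such that, whenever $x$ is a solution of the first system with observation $w$, $y(t)=H(x(t))$ is a solution of the second with the same observation $w$, and likewise $H^{-1}$ takes solutions of the second system to solutions of the first with the same observation. They are *linearly equivalent* if $H$ can be chosen to be a linear isomorphism. Let $k_{obs}(A,C)$ be the rank of the matrix with block rows $C,CA,\dots,CA^{n-1}$; $(A,C)$ is *completely observable* if $k_{obs}(A,C)=n$. A *linear equivalence canonical form* for a class of systems is a set of systems in the class such that each system of the class is linearly equivalent to exactly one member of the set, called its canonical form. **Theorem.** Every system $(A,C)$ is linearly equivalent to a system $$\left(\begin{bmatrix}A^0&0&0\\0&A^+&0\\0&0&A^-\end{bmatrix},\ \begin{bmatrix}C^0&C^+&C^-\end{bmatrix}\right)$$ in which all eigenvalues of $A^0$, $A^+$, $A^-$ have zero, positive and negative real part, respectively.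 Given any such decomposition, let $n^0,n^+,n^-$ be the sizes of $A^0,A^+,A^-$, and put $k^+=k_{obs}(A^+,C^+)\le n^+$, $k^-=k_{obs}(A^-,C^-)\le n^-$. Fix any linear equivalence canonical form for the systems of state dimension $n^0$ (and $p$ outputs) all of whose eigenvalues have zero real part, and any linear equivalence canonical form for the completely observable systems of state dimension $k^++k^-$ (and $p$ outputs) all of whose eigenvalues have nonzero real part. Then $(A,C)$ is topologically equivalent to $$\left(\begin{bmatrix}\widehat N&0&0\\0&\widehat B&0\\0&0&\widehat E\end{bmatrix},\ \begin{bmatrix}\widehat K&\widehat D&0\end{bmatrix}\right),\qquad \widehat E=\operatorname{diag}(\underbrace{1,\dots,1}_{n^+-k^+},\underbrace{-1,\dots,-1}_{n^--k^-}),$$ for some $\widehat N\in\mathbb R^{n^0\times n^0}$, $\widehat K\in\mathbb R^{p\times n^0}$, $\widehat B\in\mathbb R^{(k^++k^-)\times(k^++k^-)}$, $\widehat D\in\mathbb R^{p\times(k^++k^-)}$ such that $(\widehat N,\widehat K)$ is the canonical form of $(A^0,C^0)$ in the first family, and $(\widehat B,\widehat D)$ belongs to the second family and is an observable part of $\left(\begin{bmatrix}A^+&0\\0&A^-\end{bmatrix},\begin{bmatrix}C^+&C^-\end{bmatrix}\right)$,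 i.e. the latter system is linearly equivalent to $\left(\begin{bmatrix}\widehat B&0\\A_m&A_u\end{bmatrix},\begin{bmatrix}\widehat D&0\end{bmatrix}\right)$ for some matrices $A_m,A_u$. -/

import Mathlib

open Matrix

/-- A linear system with observation `x' = A x`, `w = C x` for `t ≥ 0`, with state space `ℝ^ι` and
observation space `ℝ^p`; it is the pair of matrices `(A, C)`. -/
@[ext]
structure ObsSystem (ι : Type*) (p : ℕ) where
  A : Matrix ι ι ℝ
  C : Matrix (Fin p) ι ℝ

namespace ObsSystem

variable {ι κ : Type*} {p : ℕ}

section Equivalence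

variable [Fintype ι] [Fintype κ]

/-- `x` solves `x' = A x` on `[0, ∞)` and `w` is the corresponding observation. -/
def IsTrajectory (S : ObsSystem ι p) (x : ℝ → ι → ℝ) (w : ℝ → Fin p → ℝ) : Prop :=
  ∀ t : ℝ, 0 ≤ t → HasDerivWithinAt x (S.A *ᵥ x t) (Set.Ici 0) t ∧ w t = S.C *ᵥ x t

/-- The transformation `(y, z) = (H x, w)` brings the system `S` to the system `T`. -/
def Brings (S : ObsSystem ι p) (T : ObsSystem κ p) (H : (ι → ℝ) → (κ → ℝ)) : Prop :=
  ∀ (x : ℝ → ι → ℝ) (w : ℝ → Fin p → ℝ),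
    S.IsTrajectory x w → T.IsTrajectory (fun t => H (x t)) w

/-- Topological equivalence of systems with observation. -/
def TopEquiv (S : ObsSystem ι p) (T : ObsSystem κ p) : Prop :=
  ∃ H : (ι → ℝ) ≃ₜ (κ → ℝ), Brings S T H ∧ Brings T S H.symm

/-- Linear equivalence of systems with observation. -/
def LinEquiv (S : ObsSystem ι p) (T : ObsSystem κ p) : Prop :=
  ∃ H : (ι → ℝ) ≃ₗ[ℝ] (κ → ℝ), Brings S T H ∧ Brings T S H.symm

end Equivalence

/-- The block-diagonal system `(diag(A₁, A₂), [C₁ C₂])`. -/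
def join (S : ObsSystem ι p) (T : ObsSystem κ p) : ObsSystem (ι ⊕ κ) p where
  A := fromBlocks S.A 0 0 T.A
  C := fromCols S.C T.C

section Indices

variable [Fintype ι] [DecidableEq ι] [Fintype κ] [DecidableEq κ]

/-- The observability matrix, with block rows `C, C A, …, C A^(n-1)` for `n = |ι|`. -/
def obsMatrix (S : ObsSystem ι p) : Matrix (Fin (Fintype.card ι) × Fin p) ι ℝ :=
  Matrix.of fun i j => (S.C * S.A ^ (i.1 : ℕ)) i.2 j

/-- The Kalman rank of observability. -/
noncomputable def kobs (S : ObsSystem ι p) : ℕ := S.obsMatrix.rank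

def CompletelyObservable (S : ObsSystem ι p) : Prop := S.kobs = Fintype.card ι

/-- All complex eigenvalues of the state matrix satisfy the predicate `P`. -/
def EigenvaluesSatisfy (S : ObsSystem ι p) (P : ℂ → Prop) : Prop :=
  ∀ z ∈ spectrum ℂ (S.A.map (algebraMap ℝ ℂ)), P z

/-- All eigenvalues have zero real part. -/
def ZeroRealParts (S : ObsSystem ι p) : Prop := S.EigenvaluesSatisfy fun z => z.re = 0

/-- All eigenvalues have nonzero real part. -/
def NonzeroRealParts (S : ObsSystem ι p) : Prop := S.EigenvaluesSatisfy fun z => z.re ≠ 0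

/-- A linear equivalence canonical form for the class `P` of systems: a set of systems of the class
such that each system of the class is linearly equivalent to exactly one member of the set. -/
def IsLinearCanonicalForm (P : ObsSystem ι p → Prop) (R : Set (ObsSystem ι p)) : Prop :=
  (∀ T ∈ R, P T) ∧ ∀ S, P S → ∃! T, T ∈ R ∧ S.LinEquiv T

/-- `T` is the observable part `(A_o, C_o)` in a Kalman decomposition
`(A_o, 0; A_m, A_u), [C_o 0]` of `S`. -/
def IsObservablePart (S : ObsSystem ι p) (T : ObsSystem κ p) : Prop :=
  T.CompletelyObservable ∧
    ∃ (m : ℕ) (Am : Matrix (Fin m) κ ℝ) (Au : Matrix (Fin m) (Fin m) ℝ),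
      S.LinEquiv (⟨fromBlocks T.A 0 Am Au, fromCols T.C 0⟩ : ObsSystem (κ ⊕ Fin m) p)

/-- A decomposition of `S`, up to linear equivalence, as
`(diag(A⁰, A⁺, A⁻), [C⁰ C⁺ C⁻])`, where the eigenvalues of `A⁰`, `A⁺`, `A⁻` have zero, positive and
negative real parts. The sizes of the blocks are `n⁰`, `n⁺`, `n⁻`. -/
structure SpectralDecomposition (S : ObsSystem ι p) where
  nZero : ℕ
  nPos : ℕ
  nNeg : ℕ
  zero : ObsSystem (Fin nZero) p
  pos : ObsSystem (Fin nPos) p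
  neg : ObsSystem (Fin nNeg) p
  zero_re : zero.EigenvaluesSatisfy fun z => z.re = 0
  pos_re : pos.EigenvaluesSatisfy fun z => 0 < z.re
  neg_re : neg.EigenvaluesSatisfy fun z => z.re < 0
  linEquiv : S.LinEquiv (zero.join (pos.join neg))

end Indices

/-- The unobserved system `(Ê, 0)`, where `Ê = diag(1, …, 1, -1, …, -1)` with `a` entries `1` and
`b` entries `-1`. -/
def signSystem (a b p : ℕ) : ObsSystem (Fin a ⊕ Fin b) p where
  A := Matrix.diagonal (Sum.elim (fun _ => 1) (fun _ => -1))
  C := 0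

end ObsSystem

/-! Only the unobserved directions have to be deformed nonlinearly. Coprime factors of the
characteristic polynomial split the system by the sign of the real parts, and the zero block is
changed only linearly. In each of the other two blocks a Kalman decomposition gives the state matrix
`(O, 0; L, U)`, with only the first component observed. It remains to conjugate this flow to that of
`diag(O, ±1)` by a homeomorphism that fixes the first component; the observation is then preserved
automatically.

Suppose the eigenvalues lie in the right half plane. For a suitable Euclidean norm every nonzero
orbit grows strictly and meets the unit sphere exactly once. Carrying a point back to the sphere
along one flow, and then forward for the same time along the other, conjugates the flows
(`IsExpanding.exists_homeomorph_conj`). Both flows cover the flow of `O` on the first component,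
where the two motions cancel. One norm must serve both flows: giving the unobserved component a
small weight makes the coupling `L` harmless (`IsExpanding.gluedNorm`). For a single matrix `a` the
norm comes from the Cayley transform `(a - 1)(a + 1)⁻¹`, which has spectral radius below one: it is
the sum of squares over the first few powers. The left half plane follows by reversing time.

The observable parts of the positive and negative blocks have disjoint spectra, so together they are
completely observable (`CompletelyObservable.join`) and have a canonical form in the second family.
-/

/-! ### Flows of linear vector fields -/

section LinearFlow

set_option linter.unusedSectionVars false

variable {E F : Type*} [NormedAddCommGroup E] [NormedSpace ℝ E] [CompleteSpace E]
  [NormedAddCommGroup F] [NormedSpace ℝ F] [CompleteSpace F]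

/-- The flow `t ↦ exp (t A)` of the linear vector field `A`. -/
noncomputable def linearFlow (A : E →L[ℝ] E) (t : ℝ) : E →L[ℝ] E := NormedSpace.exp (t • A)

@[simp]
theorem linearFlow_zero (A : E →L[ℝ] E) (x : E) : linearFlow A 0 x = x := by
  simp [linearFlow]

theorem linearFlow_add (A : E →L[ℝ] E) (s t : ℝ) (x : E) :
    linearFlow A (s + t) x = linearFlow A s (linearFlow A t x) := by
  let _ : NormedAlgebra ℚ (E →L[ℝ] E) := NormedAlgebra.restrictScalars ℚ ℝ _
  have h : Commute (s • A) (t • A) := ((Commute.refl A).smul_left s).smul_right t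
  rw [linearFlow, add_smul, NormedSpace.exp_add_of_commute h]
  rfl

theorem linearFlow_neg_left (A : E →L[ℝ] E) (t : ℝ) : linearFlow (-A) t = linearFlow A (-t) := by
  simp [linearFlow]

@[simp]
theorem linearFlow_neg_apply_self (A : E →L[ℝ] E) (t : ℝ) (x : E) :
    linearFlow A (-t) (linearFlow A t x) = x := by
  rw [← linearFlow_add]; simp

@[simp]
theorem linearFlow_apply_neg_self (A : E →L[ℝ] E) (t : ℝ) (x : E) :
    linearFlow A t (linearFlow A (-t) x) = x := by
  rw [← linearFlow_add]; simp

theorem hasDerivAt_linearFlow (A : E →L[ℝ] E) (x : E) (t : ℝ) :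
    HasDerivAt (fun s => linearFlow A s x) (A (linearFlow A t x)) t := by
  simpa [linearFlow] using (hasDerivAt_exp_smul_const' A t).clm_apply (hasDerivAt_const t x)

theorem continuous_linearFlow (A : E →L[ℝ] E) :
    Continuous fun q : ℝ × E => linearFlow A q.1 q.2 := by
  let _ : NormedAlgebra ℚ (E →L[ℝ] E) := NormedAlgebra.restrictScalars ℚ ℝ _
  have h : Continuous fun q : ℝ × E => NormedSpace.exp (q.1 • A) :=
    NormedSpace.exp_continuous.comp (by fun_prop)
  exact h.clm_apply continuous_snd

/-- A linear map that intertwines two linear vector fields intertwines their flows. -/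
theorem map_linearFlow {A : E →L[ℝ] E} {B : F →L[ℝ] F} {P : E →L[ℝ] F}
    (h : ∀ x, P (A x) = B (P x)) (t : ℝ) (x : E) :
    P (linearFlow A t x) = linearFlow B t (P x) := by
  have hpow : ∀ (n : ℕ) (x : E), P (((t • A) ^ n) x) = ((t • B) ^ n) (P x) := by
    intro n
    induction n with
    | zero => simp
    | succ n ih =>
      intro x
      rw [pow_succ, pow_succ, mul_apply_eq_comp, mul_apply_eq_comp, ih]
      simp [h]
  have hA := ((NormedSpace.exp_series_hasSum_exp' (𝕂 := ℝ) (t • A)).mapL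
    (ContinuousLinearMap.apply ℝ E x)).mapL P
  have hB := (NormedSpace.exp_series_hasSum_exp' (𝕂 := ℝ) (t • B)).mapL
    (ContinuousLinearMap.apply ℝ F (P x))
  refine hA.unique (hB.congr_fun fun n => ?_)
  simp only [map_smul, ContinuousLinearMap.apply_apply, hpow]

/-- A solution of a linear differential equation on `[0, ∞)` is given by the flow. -/
theorem eq_linearFlow_of_hasDerivWithinAt {A : E →L[ℝ] E} {x : ℝ → E}
    (hx : ∀ t, 0 ≤ t → HasDerivWithinAt x (A (x t)) (Set.Ici 0) t) {t : ℝ} (ht : 0 ≤ t) :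
    x t = linearFlow A t (x 0) := by
  -- Variation of constants: `exp (-sA) x(s)` has zero derivative.
  have hd : ∀ s, 0 ≤ s →
      HasDerivWithinAt (fun s => linearFlow (-A) s (x s)) 0 (Set.Ici 0) s := by
    intro s hs
    have h := ((hasDerivAt_exp_smul_const (-A) s).hasDerivWithinAt (s := Set.Ici 0)).clm_apply
      (hx s hs)
    simpa [linearFlow] using h
  have hc := constant_of_has_deriv_right_zero (f := fun s => linearFlow (-A) s (x s)) (a := 0)
    (b := t) (fun s hs => ((hd s hs.1).continuousWithinAt).mono Set.Icc_subset_Ici_self)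
    (fun s hs => (hd s hs.1).mono (Set.Ici_subset_Ici.2 hs.1)) t ⟨ht, le_rfl⟩
  simp only [linearFlow_neg_left, neg_zero, linearFlow_zero] at hc
  rw [← hc, linearFlow_apply_neg_self]

end LinearFlow

/-! ### Equivalences of systems in terms of flows and intertwining maps -/

namespace ObsSystem

variable {ι κ ι' κ' : Type*} {p : ℕ}

section Equivalence

variable [Fintype ι] [Fintype κ] [Fintype ι'] [Fintype κ']

/-- The vector field of a system as a continuous linear map. -/
noncomputable def field (S : ObsSystem ι p) : (ι → ℝ) →L[ℝ] (ι → ℝ) :=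
  S.A.mulVecLin.toContinuousLinearMap

@[simp]
theorem field_apply (S : ObsSystem ι p) (x : ι → ℝ) : S.field x = S.A *ᵥ x := rfl

theorem isTrajectory_linearFlow (S : ObsSystem ι p) (x : ι → ℝ) :
    S.IsTrajectory (fun t => linearFlow S.field t x)
      (fun t => S.C *ᵥ linearFlow S.field t x) :=
  fun t _ => ⟨(hasDerivAt_linearFlow S.field x t).hasDerivWithinAt, rfl⟩

/-- Every trajectory is a flow line, so its image is a flow line of the target and is differentiable
for that reason; `H` itself need not be. -/
theorem brings_of_linearFlow {S : ObsSystem ι p} {T : ObsSystem κ p} {H : (ι → ℝ) → (κ → ℝ)}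
    (hA : ∀ t x, H (linearFlow S.field t x) = linearFlow T.field t (H x))
    (hC : ∀ x, T.C *ᵥ H x = S.C *ᵥ x) : Brings S T H := by
  intro x w hx t ht
  have hsol : ∀ s, 0 ≤ s → H (x s) = linearFlow T.field s (H (x 0)) := fun s hs => by
    rw [← hA, ← eq_linearFlow_of_hasDerivWithinAt (A := S.field) (fun s hs => (hx s hs).1) hs]
  refine ⟨?_, by rw [hC]; exact (hx t ht).2⟩
  have hd := (hasDerivAt_linearFlow T.field (H (x 0)) t).hasDerivWithinAt (s := Set.Ici 0)
  rw [← hsol t ht] at hd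
  exact hd.congr (fun s hs => hsol s hs) (hsol t ht)

theorem topEquiv_of_linearFlow {S : ObsSystem ι p} {T : ObsSystem κ p}
    (H : (ι → ℝ) ≃ₜ (κ → ℝ))
    (hA : ∀ t x, H (linearFlow S.field t x) = linearFlow T.field t (H x))
    (hC : ∀ x, T.C *ᵥ H x = S.C *ᵥ x) : S.TopEquiv T := by
  refine ⟨H, brings_of_linearFlow hA hC, brings_of_linearFlow (fun t y => ?_) fun y => ?_⟩
  · rw [Homeomorph.symm_apply_eq, hA, H.apply_symm_apply]
  · rw [← hC, H.apply_symm_apply]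

theorem linEquiv_of_intertwine {S : ObsSystem ι p} {T : ObsSystem κ p}
    (H : (ι → ℝ) ≃ₗ[ℝ] (κ → ℝ)) (hA : ∀ x, H (S.A *ᵥ x) = T.A *ᵥ H x)
    (hC : ∀ x, T.C *ᵥ H x = S.C *ᵥ x) : S.LinEquiv T := by
  have hflow : ∀ t x, H (linearFlow S.field t x) = linearFlow T.field t (H x) := fun t x =>
    map_linearFlow (P := H.toContinuousLinearEquiv.toContinuousLinearMap) hA t x
  refine ⟨H, brings_of_linearFlow hflow hC, brings_of_linearFlow (fun t y => ?_) fun y => ?_⟩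
  · rw [LinearEquiv.symm_apply_eq, hflow, H.apply_symm_apply]
  · rw [← hC, H.apply_symm_apply]

/-- A linear equivalence of systems is a linear isomorphism that intertwines the state matrices and
the observation matrices. -/
theorem linEquiv_iff {S : ObsSystem ι p} {T : ObsSystem κ p} :
    S.LinEquiv T ↔ ∃ H : (ι → ℝ) ≃ₗ[ℝ] (κ → ℝ),
      (∀ x, H (S.A *ᵥ x) = T.A *ᵥ H x) ∧ ∀ x, T.C *ᵥ H x = S.C *ᵥ x := by
  refine ⟨fun ⟨H, hST, _⟩ => ⟨H, fun x => ?_, fun x => ?_⟩,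
    fun ⟨H, hA, hC⟩ => linEquiv_of_intertwine H hA hC⟩
  -- Two one-sided derivatives at time zero of the same image curve: one by linearity of `H`, the
  -- other from the equation of `T`.
  · have h := (hST _ _ (S.isTrajectory_linearFlow x) 0 le_rfl).1
    have h' : HasDerivWithinAt (fun t => H (linearFlow S.field t x))
        (H (S.A *ᵥ linearFlow S.field 0 x)) (Set.Ici 0) 0 :=
      H.toContinuousLinearEquiv.toContinuousLinearMap.hasFDerivAt.comp_hasDerivWithinAt 0
        (hasDerivAt_linearFlow S.field x 0).hasDerivWithinAt
    have := (uniqueDiffOn_Ici (0 : ℝ) 0 Set.self_mem_Ici).eq_deriv _ h' h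
    simpa using this
  · have h := (hST _ _ (S.isTrajectory_linearFlow x) 0 le_rfl).2
    simpa using h.symm

theorem LinEquiv.symm {S : ObsSystem ι p} {T : ObsSystem κ p} (h : S.LinEquiv T) :
    T.LinEquiv S := by
  obtain ⟨H, h₁, h₂⟩ := h
  exact ⟨H.symm, h₂, by simpa using h₁⟩

theorem LinEquiv.trans {S : ObsSystem ι p} {T : ObsSystem κ p} {U : ObsSystem ι' p}
    (h : S.LinEquiv T) (h' : T.LinEquiv U) : S.LinEquiv U := by
  obtain ⟨H, h₁, h₂⟩ := h
  obtain ⟨G, g₁, g₂⟩ := h'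
  exact ⟨H.trans G, fun x w hx => g₁ _ _ (h₁ x w hx), fun x w hx => h₂ _ _ (g₂ x w hx)⟩

theorem TopEquiv.trans {S : ObsSystem ι p} {T : ObsSystem κ p} {U : ObsSystem ι' p}
    (h : S.TopEquiv T) (h' : T.TopEquiv U) : S.TopEquiv U := by
  obtain ⟨H, h₁, h₂⟩ := h
  obtain ⟨G, g₁, g₂⟩ := h'
  exact ⟨H.trans G, fun x w hx => g₁ _ _ (h₁ x w hx), fun x w hx => h₂ _ _ (g₂ x w hx)⟩

theorem LinEquiv.topEquiv {S : ObsSystem ι p} {T : ObsSystem κ p} (h : S.LinEquiv T) :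
    S.TopEquiv T := by
  obtain ⟨H, h₁, h₂⟩ := h
  exact ⟨H.toContinuousLinearEquiv.toHomeomorph, h₁, h₂⟩

theorem TopEquiv.refl (S : ObsSystem ι p) : S.TopEquiv S :=
  ⟨Homeomorph.refl _, fun _ _ h => h, fun _ _ h => h⟩

theorem LinEquiv.refl (S : ObsSystem ι p) : S.LinEquiv S :=
  ⟨LinearEquiv.refl ℝ _, fun _ _ h => h, fun _ _ h => h⟩

theorem Brings.join {S : ObsSystem ι p} {S' : ObsSystem ι' p} {T : ObsSystem κ p}
    {T' : ObsSystem κ' p} {H : (ι → ℝ) → (ι' → ℝ)} {G : (κ → ℝ) → (κ' → ℝ)}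
    (hH : Brings S S' H) (hG : Brings T T' G) :
    Brings (S.join T) (S'.join T')
      (fun x => Sum.elim (H (x ∘ Sum.inl)) (G (x ∘ Sum.inr))) := by
  intro x w hx t ht
  have h₁ : S.IsTrajectory (fun t => x t ∘ Sum.inl) (fun t => S.C *ᵥ (x t ∘ Sum.inl)) := by
    refine fun t ht => ⟨?_, rfl⟩
    have h := (hx t ht).1
    rw [hasDerivWithinAt_pi] at h ⊢
    intro i
    simpa [ObsSystem.join, fromBlocks_mulVec] using h (Sum.inl i)
  have h₂ : T.IsTrajectory (fun t => x t ∘ Sum.inr) (fun t => T.C *ᵥ (x t ∘ Sum.inr)) := by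
    refine fun t ht => ⟨?_, rfl⟩
    have h := (hx t ht).1
    rw [hasDerivWithinAt_pi] at h ⊢
    intro i
    simpa [ObsSystem.join, fromBlocks_mulVec] using h (Sum.inr i)
  have k₁ := hH _ _ h₁ t ht
  have k₂ := hG _ _ h₂ t ht
  constructor
  · rw [hasDerivWithinAt_pi]
    rintro (i | i)
    · simpa [ObsSystem.join, fromBlocks_mulVec] using hasDerivWithinAt_pi.1 k₁.1 i
    · simpa [ObsSystem.join, fromBlocks_mulVec] using hasDerivWithinAt_pi.1 k₂.1 i
  · have := (hx t ht).2
    simp only [ObsSystem.join, fromCols_mulVec] at this ⊢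
    rw [this, k₁.2, k₂.2]
    rfl

theorem TopEquiv.join {S : ObsSystem ι p} {S' : ObsSystem ι' p} {T : ObsSystem κ p}
    {T' : ObsSystem κ' p} (h : S.TopEquiv S') (h' : T.TopEquiv T') :
    (S.join T).TopEquiv (S'.join T') := by
  obtain ⟨H, h₁, h₂⟩ := h
  obtain ⟨G, g₁, g₂⟩ := h'
  exact ⟨Homeomorph.sumArrowHomeomorphProdArrow.trans
    ((H.prodCongr G).trans Homeomorph.sumArrowHomeomorphProdArrow.symm), h₁.join g₁, h₂.join g₂⟩

theorem LinEquiv.join {S : ObsSystem ι p} {S' : ObsSystem ι' p} {T : ObsSystem κ p}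
    {T' : ObsSystem κ' p} (h : S.LinEquiv S') (h' : T.LinEquiv T') :
    (S.join T).LinEquiv (S'.join T') := by
  obtain ⟨H, h₁, h₂⟩ := h
  obtain ⟨G, g₁, g₂⟩ := h'
  exact ⟨(LinearEquiv.sumArrowLequivProdArrow ι κ ℝ ℝ).trans
    ((H.prodCongr G).trans (LinearEquiv.sumArrowLequivProdArrow ι' κ' ℝ ℝ).symm),
    h₁.join g₁, h₂.join g₂⟩

/-- Renaming the state coordinates. -/
theorem linEquiv_reindex (S : ObsSystem ι p) (e : ι ≃ κ) :
    S.LinEquiv (⟨S.A.submatrix e.symm e.symm, S.C.submatrix id e.symm⟩ : ObsSystem κ p) := by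
  refine linEquiv_of_intertwine (LinearEquiv.funCongrLeft ℝ ℝ e.symm) (fun x => ?_) fun x => ?_
  · ext i
    simp [LinearEquiv.funCongrLeft_apply, submatrix_mulVec_equiv,
      LinearMap.funLeft, Function.comp_assoc]
  · ext i
    simp [LinearEquiv.funCongrLeft_apply, submatrix_mulVec_equiv,
      LinearMap.funLeft, Function.comp_assoc]

end Equivalence

end ObsSystem

namespace ObsSystem

variable {ι κ : Type*} {p : ℕ}
variable [Fintype ι] [DecidableEq ι] [Fintype κ] [DecidableEq κ]

/-! ### Eigenvalue conditions through the characteristic polynomial -/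

section Eigenvalues

theorem eigenvaluesSatisfy_iff {S : ObsSystem ι p} {P : ℂ → Prop} :
    S.EigenvaluesSatisfy P ↔ ∀ z : ℂ, Polynomial.aeval z S.A.charpoly = 0 → P z := by
  unfold EigenvaluesSatisfy
  simp only [mem_spectrum_iff_isRoot_charpoly, charpoly_map, Polynomial.IsRoot.def,
    Polynomial.eval_map_algebraMap]

theorem LinEquiv.charpoly_eq {S : ObsSystem ι p} {T : ObsSystem κ p} (h : S.LinEquiv T) :
    S.A.charpoly = T.A.charpoly := by
  obtain ⟨H, hA, -⟩ := linEquiv_iff.1 h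
  rw [← charpoly_toLin' S.A, ← charpoly_toLin' T.A, ← LinearEquiv.charpoly_conj H]
  congr 1
  refine LinearMap.ext fun x => ?_
  simp [LinearEquiv.conj_apply, hA]

/-- Passes spectral conditions to the diagonal blocks of a block triangular matrix. -/
theorem EigenvaluesSatisfy.of_charpoly_dvd {S : ObsSystem ι p} {T : ObsSystem κ p} {P : ℂ → Prop}
    (hS : S.EigenvaluesSatisfy P) (h : T.A.charpoly ∣ S.A.charpoly) : T.EigenvaluesSatisfy P := by
  rw [eigenvaluesSatisfy_iff] at hS ⊢
  intro z hz
  obtain ⟨q, hq⟩ := h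
  exact hS z (by rw [hq, map_mul, hz, zero_mul])

theorem EigenvaluesSatisfy.isCoprime {S : ObsSystem ι p} {T : ObsSystem κ p} {P Q : ℂ → Prop}
    (hS : S.EigenvaluesSatisfy P) (hT : T.EigenvaluesSatisfy Q) (hPQ : ∀ z, P z → ¬ Q z) :
    IsCoprime S.A.charpoly T.A.charpoly := by
  rw [eigenvaluesSatisfy_iff] at hS hT
  rw [Polynomial.isCoprime_iff_aeval_ne_zero_of_isAlgClosed ℝ ℂ]
  intro z
  by_contra! h
  exact hPQ z (hS z h.1) (hT z h.2)

theorem EigenvaluesSatisfy.join {S : ObsSystem ι p} {T : ObsSystem κ p} {P : ℂ → Prop}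
    (hS : S.EigenvaluesSatisfy P) (hT : T.EigenvaluesSatisfy P) :
    (S.join T).EigenvaluesSatisfy P := by
  rw [eigenvaluesSatisfy_iff] at hS hT ⊢
  intro z hz
  rw [ObsSystem.join, charpoly_fromBlocks_zero₁₂, map_mul, mul_eq_zero] at hz
  exact hz.elim (hS z) (hT z)

end Eigenvalues

/-! ### Unobservable subspace and Kalman decomposition -/

section Observability

/-- The unobservable subspace `⋂ ker (C A^k)`. -/
def unobservable (S : ObsSystem ι p) : Submodule ℝ (ι → ℝ) :=
  ⨅ k : ℕ, LinearMap.ker (S.C * S.A ^ k).mulVecLin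

theorem mem_unobservable {S : ObsSystem ι p} {x : ι → ℝ} :
    x ∈ S.unobservable ↔ ∀ k : ℕ, S.C *ᵥ (S.A ^ k *ᵥ x) = 0 := by
  simp [unobservable, Submodule.mem_iInf, mulVec_mulVec]

theorem mulVec_mem_unobservable {S : ObsSystem ι p} {x : ι → ℝ} (hx : x ∈ S.unobservable) :
    S.A *ᵥ x ∈ S.unobservable := by
  rw [mem_unobservable] at hx ⊢
  intro k
  rw [mulVec_mulVec (M := S.A ^ k), ← pow_succ]
  exact hx (k + 1)

/-- By Cayley–Hamilton every power of `A` is a combination of the first `n`, so the finitely many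
block rows already impose all the conditions. -/
theorem ker_obsMatrix (S : ObsSystem ι p) :
    LinearMap.ker S.obsMatrix.mulVecLin = S.unobservable := by
  ext x
  have key : S.obsMatrix *ᵥ x = 0 ↔
      ∀ k < Fintype.card ι, S.C *ᵥ (S.A ^ k *ᵥ x) = 0 := by
    constructor
    · intro h k hk
      ext j
      rw [mulVec_mulVec]
      exact congrFun h (⟨k, hk⟩, j)
    · intro h
      ext ⟨k, j⟩
      have := congrFun (h k k.2) j
      rw [mulVec_mulVec] at this
      exact this
  rw [LinearMap.mem_ker, mulVecLin_apply, key, mem_unobservable]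
  refine ⟨fun h k => ?_, fun h k _ => h k⟩
  -- Without state coordinates the characteristic polynomial is `1` and the degree bound below
  -- fails.
  rcases isEmpty_or_nonempty ι with hι | hι
  · rw [Subsingleton.elim x 0]; simp
  have hdeg : ((Polynomial.X ^ k : Polynomial ℝ) %ₘ S.A.charpoly).natDegree < Fintype.card ι := by
    have h1 := Polynomial.natDegree_modByMonic_lt (Polynomial.X ^ k : Polynomial ℝ)
      S.A.charpoly_monic (fun h => by
        have := S.A.charpoly_natDegree_eq_dim
        rw [h] at this
        simp at this
        exact Fintype.card_ne_zero this.symm)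
    rwa [S.A.charpoly_natDegree_eq_dim] at h1
  rw [pow_eq_aeval_mod_charpoly, Polynomial.aeval_eq_sum_range' hdeg, Matrix.sum_mulVec,
    ← mulVecLin_apply S.C, map_sum]
  refine Finset.sum_eq_zero fun i hi => ?_
  rw [mulVecLin_apply, smul_mulVec, mulVec_smul, h i (Finset.mem_range.1 hi), smul_zero]

theorem kobs_add_finrank_unobservable (S : ObsSystem ι p) :
    S.kobs + Module.finrank ℝ S.unobservable = Fintype.card ι := by
  rw [← ker_obsMatrix, kobs, Matrix.rank, LinearMap.finrank_range_add_finrank_ker,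
    Module.finrank_fintype_fun_eq_card]

theorem kobs_le_card (S : ObsSystem ι p) : S.kobs ≤ Fintype.card ι :=
  S.kobs_add_finrank_unobservable ▸ Nat.le_add_right _ _

theorem completelyObservable_iff {S : ObsSystem ι p} :
    S.CompletelyObservable ↔ ∀ x : ι → ℝ, (∀ k : ℕ, S.C *ᵥ (S.A ^ k *ᵥ x) = 0) → x = 0 := by
  have h := S.kobs_add_finrank_unobservable
  have h' : S.CompletelyObservable ↔ S.unobservable = ⊥ := by
    rw [CompletelyObservable, ← Submodule.finrank_eq_zero]
    omega
  simp only [h', Submodule.eq_bot_iff, mem_unobservable]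

theorem intertwine_pow {A : Matrix ι ι ℝ} {B : Matrix κ κ ℝ} {H : (ι → ℝ) → (κ → ℝ)}
    (h : ∀ x, H (A *ᵥ x) = B *ᵥ H x) (k : ℕ) (x : ι → ℝ) :
    H (A ^ k *ᵥ x) = B ^ k *ᵥ H x := by
  induction k with
  | zero => simp
  | succ k ih => rw [pow_succ', pow_succ', ← mulVec_mulVec, ← mulVec_mulVec, h, ih]

theorem apply_mem_unobservable_iff {S : ObsSystem ι p} {T : ObsSystem κ p}
    {H : (ι → ℝ) → (κ → ℝ)} (hA : ∀ x, H (S.A *ᵥ x) = T.A *ᵥ H x)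
    (hC : ∀ x, T.C *ᵥ H x = S.C *ᵥ x) {x : ι → ℝ} :
    H x ∈ T.unobservable ↔ x ∈ S.unobservable := by
  simp only [mem_unobservable, ← intertwine_pow hA, hC]

theorem LinEquiv.completelyObservable {S : ObsSystem ι p} {T : ObsSystem κ p} (h : S.LinEquiv T)
    (hS : S.CompletelyObservable) : T.CompletelyObservable := by
  obtain ⟨H, hA, hC⟩ := linEquiv_iff.1 h.symm
  rw [completelyObservable_iff] at hS ⊢
  intro x hx
  have := hS (H x) fun k => by rw [← intertwine_pow hA, hC, hx]
  simpa using this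

/-- Every system has a Kalman observability decomposition. -/
theorem exists_kalman_decomposition (S : ObsSystem ι p) {m : ℕ} (hm : S.kobs + m = Fintype.card ι) :
    ∃ (O : ObsSystem (Fin S.kobs) p) (Am : Matrix (Fin m) (Fin S.kobs) ℝ)
      (Au : Matrix (Fin m) (Fin m) ℝ), O.CompletelyObservable ∧
      S.LinEquiv (⟨fromBlocks O.A 0 Am Au, fromCols O.C 0⟩ : ObsSystem (Fin S.kobs ⊕ Fin m) p) := by
  have hU : Module.finrank ℝ S.unobservable = m := by
    have := S.kobs_add_finrank_unobservable; omega
  obtain ⟨W, hW⟩ := Submodule.exists_isCompl S.unobservable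
  have hWd : Module.finrank ℝ W = S.kobs := by
    have := Submodule.finrank_add_eq_of_isCompl hW
    rw [Module.finrank_fintype_fun_eq_card] at this
    omega
  let e := Submodule.prodEquivOfIsCompl W S.unobservable hW.symm
  let eW : W ≃ₗ[ℝ] (Fin S.kobs → ℝ) := LinearEquiv.ofFinrankEq _ _ (by simp [hWd])
  let eU : S.unobservable ≃ₗ[ℝ] (Fin m → ℝ) := LinearEquiv.ofFinrankEq _ _ (by simp [hU])
  let H : (ι → ℝ) ≃ₗ[ℝ] (Fin S.kobs ⊕ Fin m → ℝ) :=
    e.symm.trans ((eW.prodCongr eU).trans (LinearEquiv.sumArrowLequivProdArrow _ _ ℝ ℝ).symm)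
  have hH : ∀ x, x ∈ S.unobservable ↔ H x ∘ Sum.inl = 0 := by
    intro x
    have : H x ∘ Sum.inl = eW (e.symm x).1 := rfl
    rw [this, LinearEquiv.map_eq_zero_iff]
    exact (Submodule.prodEquivOfIsCompl_symm_apply_fst_eq_zero _ _ hW.symm).symm
  let T : ObsSystem (Fin S.kobs ⊕ Fin m) p :=
    ⟨LinearMap.toMatrix' (H.conj S.A.mulVecLin),
      LinearMap.toMatrix' (S.C.mulVecLin ∘ₗ H.symm.toLinearMap)⟩
  have hA : ∀ x, H (S.A *ᵥ x) = T.A *ᵥ H x := fun x => by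
    simp [T, ← Matrix.toLin'_apply, LinearEquiv.conj_apply]
  have hC : ∀ x, T.C *ᵥ H x = S.C *ᵥ x := fun x => by
    simp [T, ← Matrix.toLin'_apply]
  -- In the new coordinates the unobservable subspace is the second summand. Its invariance kills
  -- the upper right block, and the condition for `k = 0` kills the second part of `C`.
  have hT : ∀ y, y ∈ T.unobservable ↔ y ∘ Sum.inl = 0 := fun y => by
    obtain ⟨x, rfl⟩ := H.surjective y
    rw [apply_mem_unobservable_iff hA hC, hH]
  have hu : ∀ u : Fin m → ℝ, Sum.elim (0 : Fin S.kobs → ℝ) u ∈ T.unobservable := fun u => by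
    rw [hT]; rfl
  have h₁₂ : T.A.toBlocks₁₂ = 0 := by
    apply Matrix.toLin'.injective
    refine LinearMap.ext fun u => ?_
    have h := (hT _).1 (mulVec_mem_unobservable (hu u))
    rw [← fromBlocks_toBlocks T.A, fromBlocks_mulVec] at h
    simpa using h
  have h₂ : T.C.toCols₂ = 0 := by
    apply Matrix.toLin'.injective
    refine LinearMap.ext fun u => ?_
    have h := mem_unobservable.1 (hu u) 0
    rw [← fromCols_toCols T.C, fromCols_mulVec] at h
    simpa using h
  have hTA : T.A = fromBlocks T.A.toBlocks₁₁ 0 T.A.toBlocks₂₁ T.A.toBlocks₂₂ := by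
    conv_lhs => rw [← fromBlocks_toBlocks T.A, h₁₂]
  have hTC : T.C = fromCols T.C.toCols₁ 0 := by
    conv_lhs => rw [← fromCols_toCols T.C, h₂]
  refine ⟨⟨T.A.toBlocks₁₁, T.C.toCols₁⟩, T.A.toBlocks₂₁, T.A.toBlocks₂₂, ?_, ?_⟩
  · rw [completelyObservable_iff]
    intro w hw
    have hA' : ∀ y, (T.A *ᵥ y) ∘ Sum.inl = T.A.toBlocks₁₁ *ᵥ (y ∘ Sum.inl) := fun y => by
      conv_lhs => rw [hTA, fromBlocks_mulVec]
      simp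
    have hmem : Sum.elim w (0 : Fin m → ℝ) ∈ T.unobservable := by
      rw [mem_unobservable]
      intro k
      rw [hTC, fromCols_mulVec, intertwine_pow (H := fun y => y ∘ Sum.inl) hA']
      simpa using hw k
    simpa using (hT _).1 hmem
  · dsimp only
    rw [← hTA, ← hTC]
    exact linEquiv_of_intertwine H hA hC

/-- Two completely observable systems without common eigenvalues form a completely observable
system. -/
theorem CompletelyObservable.join {S : ObsSystem ι p} {T : ObsSystem κ p}
    (hS : S.CompletelyObservable) (hT : T.CompletelyObservable)
    (h : IsCoprime S.A.charpoly T.A.charpoly) : (S.join T).CompletelyObservable := by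
  rw [completelyObservable_iff] at hS hT ⊢
  intro x hx
  set x₁ := x ∘ Sum.inl with hx₁
  set x₂ := x ∘ Sum.inr with hx₂
  have hpow : ∀ k : ℕ, S.C *ᵥ (S.A ^ k *ᵥ x₁) + T.C *ᵥ (T.A ^ k *ᵥ x₂) = 0 := by
    intro k
    have := hx k
    simpa [ObsSystem.join, fromBlocks_diagonal_pow, fromBlocks_mulVec, fromCols_mulVec] using this
  have hpoly : ∀ q : Polynomial ℝ, S.C *ᵥ (Polynomial.aeval S.A q *ᵥ x₁) +
      T.C *ᵥ (Polynomial.aeval T.A q *ᵥ x₂) = 0 := by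
    intro q
    induction q using Polynomial.induction_on' with
    | add q r hq hr =>
      simp only [map_add, add_mulVec, mulVec_add]
      rw [add_add_add_comm, hq, hr, add_zero]
    | monomial k a =>
      simp only [← Polynomial.C_mul_X_pow_eq_monomial, Polynomial.aeval_C, Polynomial.aeval_X,
        map_mul, map_pow, ← Algebra.smul_def, smul_mulVec, mulVec_smul]
      rw [← smul_add, hpow, smul_zero]
  have h₁ : x₁ = 0 := by
    have hz : Polynomial.aeval S.A T.A.charpoly *ᵥ x₁ = 0 := by
      refine hS _ fun k => ?_
      -- This polynomial annihilates the `T` summand, leaving a condition on `x₁` alone. Then `x₁`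
      -- is killed by two coprime polynomials in `S.A`.
      have := hpoly (Polynomial.X ^ k * T.A.charpoly)
      simpa [aeval_self_charpoly, ← mulVec_mulVec] using this
    obtain ⟨a, b, hab⟩ := h
    have h1 := congrArg (fun q => Polynomial.aeval S.A q *ᵥ x₁) hab
    simpa [aeval_self_charpoly, ← mulVec_mulVec, hz, add_mulVec] using h1.symm
  have h₂ : x₂ = 0 := hT _ fun k => by simpa [h₁] using hpow k
  ext (i | i)
  · exact congrFun h₁ i
  · exact congrFun h₂ i

end Observability

end ObsSystem

/-! ### Factoring real polynomials by the sign of the real parts of the roots -/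

section RealFactorization

open Polynomial

/-- All complex roots of an irreducible real polynomial have the same real part. -/
theorem Irreducible.re_eq_re_of_aeval_eq_zero {q : ℝ[X]} (hq : Irreducible q) {z w : ℂ}
    (hz : aeval z q = 0) (hw : aeval w q = 0) : z.re = w.re := by
  -- The real polynomial with roots `z` and its conjugate. Up to a unit `q` is the minimal
  -- polynomial of `z`, so it divides `r`.
  let r : ℝ[X] := X ^ 2 - C (2 * z.re) * X + C (z.re ^ 2 + z.im ^ 2)
  have hr : ∀ u : ℂ, aeval u r = (u - z) * (u - (starRingEnd ℂ) z) := by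
    intro u
    have h1 : (starRingEnd ℂ) z = z.re - z.im * Complex.I := by
      apply Complex.ext <;> simp
    have h2 : z = z.re + z.im * Complex.I := (Complex.re_add_im z).symm
    rw [h1]
    simp only [r, map_add, map_sub, map_mul, map_pow, aeval_X, aeval_C, Complex.coe_algebraMap]
    push_cast
    linear_combination (z.im : ℂ) ^ 2 * Complex.I_sq + (u - (z.re - z.im * Complex.I)) * h2
  have hdvd : q ∣ r := by
    have hint : IsIntegral ℝ z := Algebra.IsIntegral.isIntegral z
    have h1 : minpoly ℝ z ∣ q := minpoly.dvd ℝ z hz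
    have h2 : minpoly ℝ z ∣ r := minpoly.dvd ℝ z (by simp [hr])
    exact ((minpoly.irreducible hint).associated_of_dvd hq h1).symm.dvd.trans h2
  obtain ⟨s, hs⟩ := hdvd
  have : aeval w r = 0 := by rw [hs, map_mul, hw, zero_mul]
  rw [hr, mul_eq_zero, sub_eq_zero, sub_eq_zero] at this
  rcases this with h | h <;> simp [h]

/-- A nonzero real polynomial is a product of polynomials whose complex roots have zero, positive
and negative real parts. -/
theorem Polynomial.exists_factorization_by_sign_of_re (q : ℝ[X]) (hq : q ≠ 0) :
    ∃ a b c : ℝ[X], q = a * (b * c) ∧ (∀ z : ℂ, aeval z a = 0 → z.re = 0) ∧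
      (∀ z : ℂ, aeval z b = 0 → 0 < z.re) ∧ ∀ z : ℂ, aeval z c = 0 → z.re < 0 := by
  induction q using WfDvdMonoid.induction_on_irreducible with
  | zero => exact absurd rfl hq
  | unit u hu =>
    have h1 : ∀ v : ℝ[X], IsUnit v → ∀ z : ℂ, aeval z v ≠ 0 := fun v hv z =>
      (hv.map (aeval z)).ne_zero
    exact ⟨u, 1, 1, by simp, fun z hz => absurd hz (h1 u hu z), by simp, by simp⟩
  | mul q i hq0 hi ih =>
    obtain ⟨a, b, c, rfl, ha, hb, hc⟩ := ih hq0
    obtain ⟨z₀, hz₀⟩ : ∃ z : ℂ, aeval z i = 0 :=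
      IsAlgClosed.exists_aeval_eq_zero ℂ i (degree_pos_of_irreducible hi).ne'
    have hre : ∀ z : ℂ, aeval z i = 0 → z.re = z₀.re := fun z hz =>
      hi.re_eq_re_of_aeval_eq_zero hz hz₀
    rcases lt_trichotomy z₀.re 0 with h | h | h
    · refine ⟨a, b, i * c, by ring, ha, hb, fun z hz => ?_⟩
      rw [map_mul, mul_eq_zero] at hz
      exact hz.elim (fun h' => hre z h' ▸ h) (hc z)
    · refine ⟨i * a, b, c, by ring, fun z hz => ?_, hb, hc⟩
      rw [map_mul, mul_eq_zero] at hz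
      exact hz.elim (fun h' => hre z h' ▸ h) (ha z)
    · refine ⟨a, i * b, c, by ring, ha, fun z hz => ?_, hc⟩
      rw [map_mul, mul_eq_zero] at hz
      exact hz.elim (fun h' => hre z h' ▸ h) (hb z)

end RealFactorization

/-! ### Spectral decomposition of a system -/

namespace ObsSystem

variable {ι κ : Type*} {p : ℕ}
variable [Fintype ι] [DecidableEq ι] [Fintype κ] [DecidableEq κ]

theorem intertwine_aeval {A : Matrix ι ι ℝ} {B : Matrix κ κ ℝ} (H : (ι → ℝ) →ₗ[ℝ] (κ → ℝ))
    (h : ∀ x, H (A *ᵥ x) = B *ᵥ H x) (q : Polynomial ℝ) (x : ι → ℝ) :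
    H (Polynomial.aeval A q *ᵥ x) = Polynomial.aeval B q *ᵥ H x := by
  induction q using Polynomial.induction_on' with
  | add q r hq hr => simp only [map_add, add_mulVec, hq, hr]
  | monomial k a =>
    simp only [← Polynomial.C_mul_X_pow_eq_monomial, Polynomial.aeval_C, Polynomial.aeval_X,
      map_mul, map_pow, ← Algebra.smul_def, smul_mulVec, map_smul, intertwine_pow h]

/-- Spectral mapping: `q` sends each eigenvalue into the spectrum of `q(A) = 0`. -/
theorem eigenvaluesSatisfy_of_aeval_eq_zero {S : ObsSystem ι p} {q : Polynomial ℝ} {P : ℂ → Prop}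
    (hS : Polynomial.aeval S.A q = 0) (hq : ∀ z : ℂ, Polynomial.aeval z q = 0 → P z) :
    S.EigenvaluesSatisfy P := by
  intro z hz
  refine hq z ?_
  have hnt : Nontrivial (Matrix ι ι ℂ) := by
    by_contra h
    rw [not_nontrivial_iff_subsingleton] at h
    rw [spectrum.of_subsingleton] at hz
    exact hz
  have h0 : Polynomial.aeval (S.A.map (algebraMap ℝ ℂ)) (q.map (algebraMap ℝ ℂ)) = 0 := by
    rw [Polynomial.aeval_map_algebraMap]
    have := Polynomial.aeval_algHom_apply (Algebra.ofId ℝ ℂ).mapMatrix S.A q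
    rw [hS, map_zero] at this
    exact this
  have h1 := spectrum.subset_polynomial_aeval (S.A.map (algebraMap ℝ ℂ))
    (q.map (algebraMap ℝ ℂ)) ⟨z, hz, rfl⟩
  rw [h0, spectrum.zero_eq, Set.mem_singleton_iff] at h1
  simpa [Polynomial.eval_map_algebraMap] using h1

/-- A factorization of an annihilating polynomial into coprime factors splits the system. -/
theorem exists_linEquiv_join_of_isCoprime (S : ObsSystem ι p) {a b : Polynomial ℝ}
    (hab : IsCoprime a b) (h : Polynomial.aeval S.A (a * b) = 0) :
    ∃ (k m : ℕ) (S₁ : ObsSystem (Fin k) p) (S₂ : ObsSystem (Fin m) p),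
      Polynomial.aeval S₁.A a = 0 ∧ Polynomial.aeval S₂.A b = 0 ∧ S.LinEquiv (S₁.join S₂) := by
  have hlin : ∀ q : Polynomial ℝ, Polynomial.aeval (toLin' S.A) q =
      toLin' (Polynomial.aeval S.A q) := fun q =>
    Polynomial.aeval_algHom_apply (toLinAlgEquiv' : Matrix ι ι ℝ ≃ₐ[ℝ] _) S.A q
  have hcompl : IsCompl (LinearMap.ker (Polynomial.aeval (toLin' S.A) a))
      (LinearMap.ker (Polynomial.aeval (toLin' S.A) b)) := by
    refine ⟨Polynomial.disjoint_ker_aeval_of_isCoprime _ hab, ?_⟩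
    -- The two kernels span the kernel of `(a * b)(A) = 0`, which is the whole space.
    rw [codisjoint_iff, Polynomial.sup_ker_aeval_eq_ker_aeval_mul_of_coprime _ hab, hlin, h]
    simp
  have hpart : ∀ q : Polynomial ℝ, ∃ (k : ℕ) (R : ObsSystem (Fin k) p)
      (e : (Fin k → ℝ) ≃ₗ[ℝ] LinearMap.ker (Polynomial.aeval (toLin' S.A) q)),
      (∀ x, (e (R.A *ᵥ x) : ι → ℝ) = S.A *ᵥ (e x : ι → ℝ)) ∧
      (∀ x, R.C *ᵥ x = S.C *ᵥ (e x : ι → ℝ)) ∧ Polynomial.aeval R.A q = 0 := by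
    intro q
    set U := LinearMap.ker (Polynomial.aeval (toLin' S.A) q) with hU
    have hinv : ∀ x ∈ U, toLin' S.A x ∈ U := by
      intro x hx
      rw [hU, LinearMap.mem_ker, hlin, toLin'_apply] at hx ⊢
      have hcomm : Polynomial.aeval S.A q * S.A = S.A * Polynomial.aeval S.A q := by
        simpa using congrArg (Polynomial.aeval S.A) (mul_comm q Polynomial.X)
      rw [toLin'_apply, mulVec_mulVec, hcomm, ← mulVec_mulVec, hx, mulVec_zero]
    let e : (Fin (Module.finrank ℝ U) → ℝ) ≃ₗ[ℝ] U := LinearEquiv.ofFinrankEq _ _ (by simp)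
    let R : ObsSystem (Fin (Module.finrank ℝ U)) p :=
      ⟨LinearMap.toMatrix' (e.symm.conj ((toLin' S.A).restrict hinv)),
        LinearMap.toMatrix' (toLin' S.C ∘ₗ U.subtype ∘ₗ e.toLinearMap)⟩
    have hA : ∀ x, (e (R.A *ᵥ x) : ι → ℝ) = S.A *ᵥ (e x : ι → ℝ) := fun x => by
      rw [← toLin'_apply R.A]
      simp [R, LinearEquiv.conj_apply]
    refine ⟨_, R, e, hA, fun x => ?_, ?_⟩
    · rw [← toLin'_apply R.C]
      simp [R]
    · apply Matrix.toLin'.injective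
      refine LinearMap.ext fun x => e.injective (Subtype.ext ?_)
      have h1 := intertwine_aeval (U.subtype ∘ₗ e.toLinearMap) hA q x
      have h2 : Polynomial.aeval S.A q *ᵥ (e x : ι → ℝ) = 0 := by
        have : Polynomial.aeval (toLin' S.A) q (e x : ι → ℝ) = 0 := (e x).2
        rwa [hlin, toLin'_apply] at this
      simpa [h2] using h1
  obtain ⟨k, S₁, e₁, hA₁, hC₁, h₁⟩ := hpart a
  obtain ⟨m, S₂, e₂, hA₂, hC₂, h₂⟩ := hpart b
  refine ⟨k, m, S₁, S₂, h₁, h₂, LinEquiv.symm (linEquiv_of_intertwine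
    ((LinearEquiv.sumArrowLequivProdArrow _ _ ℝ ℝ).trans
      ((e₁.prodCongr e₂).trans (Submodule.prodEquivOfIsCompl _ _ hcompl))) ?_ ?_)⟩
  · intro y
    have hK : ∀ y : Fin k ⊕ Fin m → ℝ, ((LinearEquiv.sumArrowLequivProdArrow _ _ ℝ ℝ).trans
      ((e₁.prodCongr e₂).trans (Submodule.prodEquivOfIsCompl _ _ hcompl))) y =
        (e₁ (y ∘ Sum.inl) : ι → ℝ) + (e₂ (y ∘ Sum.inr) : ι → ℝ) := fun y => rfl
    rw [hK, hK, mulVec_add, ← hA₁, ← hA₂, ObsSystem.join, fromBlocks_mulVec]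
    simp
  · intro y
    change S.C *ᵥ ((e₁ (y ∘ Sum.inl) : ι → ℝ) + (e₂ (y ∘ Sum.inr) : ι → ℝ)) = _
    rw [mulVec_add, ← hC₁, ← hC₂, ObsSystem.join, fromCols_mulVec]

theorem nonempty_spectralDecomposition (S : ObsSystem ι p) :
    Nonempty S.SpectralDecomposition := by
  obtain ⟨a, b, c, habc, ha, hb, hc⟩ :=
    S.A.charpoly.exists_factorization_by_sign_of_re S.A.charpoly_monic.ne_zero
  have hbc : IsCoprime b c := by
    rw [Polynomial.isCoprime_iff_aeval_ne_zero_of_isAlgClosed ℝ ℂ]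
    intro z
    by_contra! h
    exact lt_asymm (hb z h.1) (hc z h.2)
  have habc' : IsCoprime a (b * c) := by
    rw [Polynomial.isCoprime_iff_aeval_ne_zero_of_isAlgClosed ℝ ℂ]
    intro z
    by_contra! h
    rw [map_mul, mul_eq_zero] at h
    exact h.2.elim (fun h' => (hb z h').ne' (ha z h.1)) (fun h' => (hc z h').ne (ha z h.1))
  obtain ⟨k, m, S₀, S', h₀, h', hS⟩ := S.exists_linEquiv_join_of_isCoprime habc'
    (by rw [← habc, aeval_self_charpoly])
  obtain ⟨k', m', S₁, S₂, h₁, h₂, hS'⟩ := S'.exists_linEquiv_join_of_isCoprime hbc h'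
  exact ⟨⟨k, k', m', S₀, S₁, S₂, eigenvaluesSatisfy_of_aeval_eq_zero h₀ ha,
    eigenvaluesSatisfy_of_aeval_eq_zero h₁ hb, eigenvaluesSatisfy_of_aeval_eq_zero h₂ hc,
    hS.trans ((LinEquiv.refl _).join hS')⟩⟩

end ObsSystem

/-! ### Conjugating expanding flows through a common unit sphere -/

section ExpandingFlows

open Filter Topology

variable {E F G : Type*} [NormedAddCommGroup E] [NormedSpace ℝ E] [CompleteSpace E]
  [NormedAddCommGroup F] [InnerProductSpace ℝ F]
  [NormedAddCommGroup G] [NormedSpace ℝ G] [CompleteSpace G]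

/-- The vector field `A` is expanding, with rate `c`, for the Euclidean seminorm `‖T ·‖`. -/
def IsExpanding (T : E →L[ℝ] F) (c : ℝ) (A : E →L[ℝ] E) : Prop :=
  ∀ x, c * ‖T x‖ ^ 2 ≤ inner ℝ (T x) (T (A x))

namespace IsExpanding

variable {T : E →L[ℝ] F} {c : ℝ} {A B : E →L[ℝ] E}

/-- A Grönwall argument: the squared seminorm along the orbit, multiplied by `exp (-2ct)`, is
nondecreasing. -/
theorem exp_mul_norm_le (hA : IsExpanding T c A) (x : E) {t : ℝ} (ht : 0 ≤ t) :
    Real.exp (c * t) * ‖T x‖ ≤ ‖T (linearFlow A t x)‖ := by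
  let g : ℝ → ℝ := fun t => Real.exp (-(2 * c * t)) * ‖T (linearFlow A t x)‖ ^ 2
  have hg : ∀ t, HasDerivAt g (Real.exp (-(2 * c * t)) * -(2 * c) * ‖T (linearFlow A t x)‖ ^ 2 +
      Real.exp (-(2 * c * t)) *
        (2 * inner ℝ (T (linearFlow A t x)) (T (A (linearFlow A t x))))) t := by
    intro t
    have h1 : HasDerivAt (fun t => -(2 * c * t)) (-(2 * c)) t := by
      simpa using ((hasDerivAt_id t).const_mul (2 * c)).fun_neg
    have h2 : HasDerivAt (fun t => T (linearFlow A t x)) (T (A (linearFlow A t x))) t :=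
      T.hasFDerivAt.comp_hasDerivAt t (hasDerivAt_linearFlow A x t)
    exact h1.exp.mul h2.norm_sq
  have hmono : Monotone g := by
    refine monotone_of_deriv_nonneg (fun t => (hg t).differentiableAt) fun t => ?_
    rw [(hg t).deriv]
    have := hA (linearFlow A t x)
    have h3 : Real.exp (-(2 * c * t)) * -(2 * c) * ‖T (linearFlow A t x)‖ ^ 2 +
      Real.exp (-(2 * c * t)) *
        (2 * inner ℝ (T (linearFlow A t x)) (T (A (linearFlow A t x)))) =
      Real.exp (-(2 * c * t)) * (2 * (inner ℝ (T (linearFlow A t x)) (T (A (linearFlow A t x))) -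
        c * ‖T (linearFlow A t x)‖ ^ 2)) := by ring
    rw [h3]
    exact mul_nonneg (Real.exp_pos _).le (by linarith)
  have h0 := hmono ht
  simp only [g, mul_zero, neg_zero, Real.exp_zero, one_mul, linearFlow_zero] at h0
  refine le_of_sq_le_sq ?_ (norm_nonneg _)
  rw [mul_pow, ← Real.exp_nat_mul]
  calc Real.exp ((2 : ℕ) * (c * t)) * ‖T x‖ ^ 2
      ≤ Real.exp ((2 : ℕ) * (c * t)) *
        (Real.exp (-(2 * c * t)) * ‖T (linearFlow A t x)‖ ^ 2) := by gcongr
    _ = ‖T (linearFlow A t x)‖ ^ 2 := by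
      rw [← mul_assoc, ← Real.exp_add]
      push_cast
      rw [show 2 * (c * t) + -(2 * c * t) = 0 by ring, Real.exp_zero, one_mul]

theorem strictAnti_norm (hA : IsExpanding T c A) (hc : 0 < c) {x : E}
    (hx : ∀ s, T (linearFlow A s x) ≠ 0) :
    StrictAnti fun s => ‖T (linearFlow A (-s) x)‖ := by
  intro s t hst
  have h := hA.exp_mul_norm_le (linearFlow A (-t) x) (sub_nonneg.2 hst.le)
  rw [← linearFlow_add, show t - s + -t = -s by ring] at h
  refine lt_of_lt_of_le ?_ h
  exact lt_mul_of_one_lt_left (norm_pos_iff.2 (hx _))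
    (Real.one_lt_exp_iff.2 (mul_pos hc (sub_pos.2 hst)))

/-- For an expanding flow, the time at which an orbit crosses the unit sphere depends continuously
on the point. -/
theorem exists_crossingTime (hA : IsExpanding T c A) (hc : 0 < c)
    (hT : Function.Injective T) :
    ∃ τ : E → ℝ, (∀ x, x ≠ 0 → ∀ s, ‖T (linearFlow A (-s) x)‖ = 1 ↔ s = τ x) ∧
      (∀ x, x ≠ 0 → ∀ s, ‖T (linearFlow A (-s) x)‖ < 1 → τ x < s) ∧
      ∀ x, x ≠ 0 → ContinuousAt τ x := by
  have hcont : ∀ s, Continuous fun x => ‖T (linearFlow A (-s) x)‖ := fun s => by fun_prop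
  have hne : ∀ x, x ≠ 0 → ∀ s, T (linearFlow A s x) ≠ 0 := by
    intro x hx s h
    apply hx
    rw [map_eq_zero_iff T hT] at h
    rw [← linearFlow_neg_apply_self A s x, h, map_zero]
  have hex : ∀ x, x ≠ 0 → ∃ s, ‖T (linearFlow A (-s) x)‖ = 1 := by
    intro x hx
    have hpos : 0 < ‖T x‖ := by simpa using hne x hx 0
    have hcs : Continuous fun s => ‖T (linearFlow A (-s) x)‖ :=
      (T.continuous.comp ((continuous_linearFlow A).comp
        (continuous_neg.prodMk continuous_const))).norm
    refine mem_range_of_exists_le_of_exists_ge hcs ?_ ?_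
    -- With `y = ‖T x‖`, the bound `exp y ≥ 1 + y` shows that going back for time `y / c` enters the
    -- unit ball. Below, going forward for time `y⁻¹ / c` leaves it.
    · refine ⟨‖T x‖ / c, ?_⟩
      have h := hA.exp_mul_norm_le (linearFlow A (-(‖T x‖ / c)) x) (div_pos hpos hc).le
      rw [linearFlow_apply_neg_self, mul_div_cancel₀ _ hc.ne'] at h
      have h1 := Real.add_one_le_exp ‖T x‖
      by_contra! h2
      have h3 := mul_lt_mul_of_pos_left h2 (Real.exp_pos ‖T x‖)
      linarith
    · refine ⟨-(‖T x‖⁻¹ / c), ?_⟩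
      have h := hA.exp_mul_norm_le x (div_pos (inv_pos.2 hpos) hc).le
      rw [mul_div_cancel₀ _ hc.ne'] at h
      have h1 := Real.add_one_le_exp ‖T x‖⁻¹
      have h2 := mul_le_mul_of_nonneg_right h1 hpos.le
      rw [add_mul, inv_mul_cancel₀ hpos.ne'] at h2
      rw [neg_neg]
      linarith
  choose! τ hτ using hex
  have hanti : ∀ x, x ≠ 0 → StrictAnti fun s => ‖T (linearFlow A (-s) x)‖ := fun x hx =>
    hA.strictAnti_norm hc (hne x hx)
  have hlt : ∀ x, x ≠ 0 → ∀ s, ‖T (linearFlow A (-s) x)‖ < 1 ↔ τ x < s := fun x hx s => by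
    rw [← hτ x hx]
    exact (hanti x hx).lt_iff_gt
  have hgt : ∀ x, x ≠ 0 → ∀ s, 1 < ‖T (linearFlow A (-s) x)‖ ↔ s < τ x := fun x hx s => by
    rw [← hτ x hx]
    exact (hanti x hx).lt_iff_gt
  refine ⟨τ, fun x hx s => ?_, fun x hx s => (hlt x hx s).1, fun x hx => ?_⟩
  · rw [← hτ x hx]
    exact (hanti x hx).injective.eq_iff
  · have hev : ∀ᶠ y in 𝓝 x, y ≠ 0 := isOpen_ne.mem_nhds hx
    -- Comparing the crossing time with a fixed `a` amounts to comparing the norm at time `-a` with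
    -- `1`, an open condition on the point.
    refine tendsto_order.2 ⟨fun a ha => ?_, fun a ha => ?_⟩
    · filter_upwards [hev, (hcont a).continuousAt.eventually_const_lt ((hgt x hx a).2 ha)]
        with y hy h using (hgt y hy a).1 h
    · filter_upwards [hev, (hcont a).continuousAt.eventually_lt_const ((hlt x hx a).2 ha)]
        with y hy h using (hlt y hy a).1 h

/-- The map that carries the orbits of `A` to those of `B` and fixes the unit sphere, expressed
through the crossing time `τ` of `A`, is continuous. -/
theorem continuous_orbitMap (hB : IsExpanding T c B) (hc : 0 < c)
    {K : ℝ} (hK : ∀ x, ‖x‖ ≤ K * ‖T x‖) {τ : E → ℝ}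
    (hτ : ∀ x, x ≠ 0 → ∀ s, ‖T (linearFlow A (-s) x)‖ = 1 ↔ s = τ x)
    (hlt : ∀ x, x ≠ 0 → ∀ s, ‖T (linearFlow A (-s) x)‖ < 1 → τ x < s)
    (hcont : ∀ x, x ≠ 0 → ContinuousAt τ x) {f : E → E} (hf0 : f 0 = 0)
    (hf : ∀ x, x ≠ 0 → f x = linearFlow B (τ x) (linearFlow A (-τ x) x)) :
    Continuous f := by
  rw [continuous_iff_continuousAt]
  intro x
  by_cases hx : x = 0
  · subst hx
    -- Continuity at the origin: such an `x` crosses the sphere at `τ x ≤ a`. The `B`-orbit of `f x`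
    -- needs time `-τ x` to reach the sphere, so `f x` is exponentially small.
    have hbound : ∀ x, ∀ a ≤ 0, ‖T (linearFlow A (-a) x)‖ < 1 → ‖T (f x)‖ ≤ Real.exp (c * a) := by
      intro x a ha hxa
      by_cases hx : x = 0
      · subst hx; simp [hf0, Real.exp_nonneg]
      have h1 := (hlt x hx a hxa).le
      have h2 := hB.exp_mul_norm_le (linearFlow B (τ x) (linearFlow A (-τ x) x))
        (neg_nonneg.2 (h1.trans ha))
      rw [linearFlow_neg_apply_self, (hτ x hx _).2 rfl, ← hf x hx] at h2
      calc ‖T (f x)‖ = Real.exp (c * τ x) * (Real.exp (c * -τ x) * ‖T (f x)‖) := by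
            rw [← mul_assoc, ← Real.exp_add]; simp
        _ ≤ Real.exp (c * τ x) * 1 := by gcongr
        _ ≤ Real.exp (c * a) := by rw [mul_one]; gcongr
    have hTf : Tendsto (fun x => ‖T (f x)‖) (𝓝 0) (𝓝 0) := by
      rw [Metric.tendsto_nhds]
      intro ε hε
      have hlim : Tendsto (fun a => Real.exp (c * a)) atBot (𝓝 0) :=
        Real.tendsto_exp_atBot.comp (tendsto_id.const_mul_atBot hc)
      obtain ⟨a, ha, ha0⟩ := ((hlim.eventually_lt_const hε).and (eventually_le_atBot 0)).exists
      have hca : Continuous fun x => ‖T (linearFlow A (-a) x)‖ := by fun_prop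
      have hev : ∀ᶠ x in 𝓝 (0 : E), ‖T (linearFlow A (-a) x)‖ < 1 :=
        hca.continuousAt.eventually_lt_const (by simp)
      filter_upwards [hev] with x hx
      simpa using (hbound x a ha0 hx).trans_lt ha
    rw [ContinuousAt, hf0]
    refine squeeze_zero_norm (fun x => hK (f x)) ?_
    simpa using hTf.const_mul K
  · have h1 : ContinuousAt (fun x => linearFlow B (τ x) (linearFlow A (-τ x) x)) x :=
      (continuous_linearFlow B).continuousAt.comp ((hcont x hx).prodMk
        ((continuous_linearFlow A).continuousAt.comp ((hcont x hx).neg.prodMk continuousAt_id)))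
    refine h1.congr ?_
    filter_upwards [isOpen_ne.mem_nhds hx] with y hy using (hf y hy).symm

/-- Two linear vector fields that are expanding for the same Euclidean norm have topologically
conjugate flows; if both cover the same vector field under `P`, then the conjugacy respects the
fibres of `P`. -/
theorem exists_homeomorph_conj (hA : IsExpanding T c A) (hB : IsExpanding T c B) (hc : 0 < c)
    {K : ℝ} (hK : ∀ x, ‖x‖ ≤ K * ‖T x‖) {P : E →L[ℝ] G} {D : G →L[ℝ] G}
    (hPA : ∀ x, P (A x) = D (P x)) (hPB : ∀ x, P (B x) = D (P x)) :
    ∃ H : E ≃ₜ E, (∀ t x, H (linearFlow A t x) = linearFlow B t (H x)) ∧ ∀ x, P (H x) = P x := by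
  classical
  have hT : Function.Injective T := (injective_iff_map_eq_zero T).2 fun x hx => by
    simpa [hx] using hK x
  obtain ⟨τ, hτ, hτlt, hτc⟩ := hA.exists_crossingTime hc hT
  obtain ⟨σ, hσ, hσlt, hσc⟩ := hB.exists_crossingTime hc hT
  let f : E → E := fun x => if x = 0 then 0 else linearFlow B (τ x) (linearFlow A (-τ x) x)
  let g : E → E := fun x => if x = 0 then 0 else linearFlow A (σ x) (linearFlow B (-σ x) x)
  have hf0 : f 0 = 0 := if_pos rfl
  have hg0 : g 0 = 0 := if_pos rfl
  have hf : ∀ x, x ≠ 0 → f x = linearFlow B (τ x) (linearFlow A (-τ x) x) := fun x hx => if_neg hx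
  have hg : ∀ x, x ≠ 0 → g x = linearFlow A (σ x) (linearFlow B (-σ x) x) := fun x hx => if_neg hx
  have hne : ∀ (M : E →L[ℝ] E) s x, x ≠ 0 → linearFlow M s x ≠ 0 := by
    intro M s x hx h
    apply hx
    rw [← linearFlow_neg_apply_self M s x, h, map_zero]
  have hfne : ∀ x, x ≠ 0 → f x ≠ 0 := fun x hx => by
    rw [hf x hx]; exact hne _ _ _ (hne _ _ _ hx)
  have hgne : ∀ x, x ≠ 0 → g x ≠ 0 := fun x hx => by
    rw [hg x hx]; exact hne _ _ _ (hne _ _ _ hx)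
  have hgf : ∀ x, g (f x) = x := by
    intro x
    by_cases hx : x = 0
    · rw [hx, hf0, hg0]
    -- The orbits of `x` under `A` and of `f x` under `B` meet the sphere at the same point after
    -- the same time, so `g` retraces `f`.
    have h1 : τ x = σ (f x) := by
      rw [← hσ _ (hfne x hx), hf x hx, linearFlow_neg_apply_self]
      exact (hτ x hx _).2 rfl
    rw [hg _ (hfne x hx), ← h1, hf x hx, linearFlow_neg_apply_self, linearFlow_apply_neg_self]
  have hfg : ∀ x, f (g x) = x := by
    intro x
    by_cases hx : x = 0
    · rw [hx, hg0, hf0]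
    have h1 : σ x = τ (g x) := by
      rw [← hτ _ (hgne x hx), hg x hx, linearFlow_neg_apply_self]
      exact (hσ x hx _).2 rfl
    rw [hf _ (hgne x hx), ← h1, hg x hx, linearFlow_neg_apply_self, linearFlow_apply_neg_self]
  refine ⟨⟨⟨f, g, hgf, hfg⟩, hB.continuous_orbitMap hc hK hτ hτlt hτc hf0 hf,
    hA.continuous_orbitMap hc hK hσ hσlt hσc hg0 hg⟩, fun t x => ?_, fun x => ?_⟩
  · change f _ = linearFlow B t (f x)
    by_cases hx : x = 0
    · simp [hx, hf0]
    have h1 : t + τ x = τ (linearFlow A t x) := by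
      rw [← hτ _ (hne _ _ _ hx), ← linearFlow_add, show -(t + τ x) + t = -τ x by ring]
      exact (hτ x hx _).2 rfl
    rw [hf _ (hne _ _ _ hx), ← h1, hf x hx, linearFlow_add, ← linearFlow_add A,
      show -(t + τ x) + t = -τ x by ring]
  · change P (f x) = P x
    by_cases hx : x = 0
    · rw [hx, hf0]
    rw [hf x hx, map_linearFlow hPB, map_linearFlow hPA, linearFlow_apply_neg_self]

end IsExpanding

end ExpandingFlows

/-! ### The Cayley transform of an element with spectrum in the right half plane -/

section Cayley

open Filter

variable {𝔸 : Type*} [NormedRing 𝔸] [NormedAlgebra ℂ 𝔸]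

theorem isUnit_add_algebraMap_of_re_pos {a : 𝔸} (ha : ∀ z ∈ spectrum ℂ a, 0 < z.re) {w : ℂ}
    (hw : 0 ≤ w.re) : IsUnit (a + algebraMap ℂ 𝔸 w) := by
  have h : -w ∉ spectrum ℂ a := fun h => by
    have := ha _ h
    rw [Complex.neg_re] at this
    linarith
  rw [spectrum.notMem_iff] at h
  simpa [add_comm] using h.neg

theorem exists_norm_pow_lt_one_of_spectrum [CompleteSpace 𝔸] {b : 𝔸}
    (hb : ∀ z ∈ spectrum ℂ b, ‖z‖ < 1) : ∃ m : ℕ, 0 < m ∧ ‖b ^ m‖ < 1 := by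
  rcases subsingleton_or_nontrivial 𝔸 with h | h
  · refine ⟨1, one_pos, ?_⟩
    rw [Subsingleton.elim (b ^ 1) 0, norm_zero]
    exact one_pos
  have hrad : spectralRadius ℂ b < (1 : NNReal) :=
    spectrum.spectralRadius_lt_of_forall_lt b fun z hz => hb z hz
  obtain ⟨m, hm, hm0⟩ := (((spectrum.pow_nnnorm_pow_one_div_tendsto_nhds_spectralRadius
    b).eventually_lt_const hrad).and (eventually_gt_atTop 0)).exists
  refine ⟨m, hm0, ?_⟩
  by_contra! h1
  have h2 : (1 : ENNReal) ≤ ‖b ^ m‖₊ := ENNReal.one_le_coe_iff.2 h1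
  exact hm.not_ge (ENNReal.one_le_rpow h2 (by positivity))

/-- The Cayley transform of an element whose spectrum lies in the right half plane is a contraction
up to taking powers. -/
theorem exists_cayley_norm_pow_lt_one [CompleteSpace 𝔸] {a : 𝔸}
    (ha : ∀ z ∈ spectrum ℂ a, 0 < z.re) :
    ∃ M : 𝔸, M * (a + 1) = a - 1 ∧ ∃ m : ℕ, 0 < m ∧ ‖M ^ m‖ < 1 := by
  obtain ⟨u, hu⟩ : IsUnit (a + 1) := by
    simpa using isUnit_add_algebraMap_of_re_pos ha (w := 1) (by simp)
  have hM : ((a - 1) * ↑u⁻¹) * (a + 1) = a - 1 := by rw [← hu, Units.inv_mul_cancel_right]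
  refine ⟨(a - 1) * ↑u⁻¹, hM, exists_norm_pow_lt_one_of_spectrum fun z hz => ?_⟩
  by_contra! hz1
  rw [spectrum.mem_iff] at hz
  apply hz
  -- For `1 ≤ ‖z‖`, the first factor is `2` if `z = 1` and otherwise `(z - 1)(a + (z + 1)/(z - 1))`.
  -- It is a unit because `(z + 1)/(z - 1)` has real part `(‖z‖² - 1)/‖z - 1‖² ≥ 0`.
  have hfac : algebraMap ℂ 𝔸 z - (a - 1) * ↑u⁻¹ =
      (algebraMap ℂ 𝔸 z * (a + 1) - (a - 1)) * ↑u⁻¹ := by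
    rw [sub_mul (algebraMap ℂ 𝔸 z * (a + 1)), ← hu, Units.mul_inv_cancel_right]
  rw [hfac]
  refine IsUnit.mul ?_ u⁻¹.isUnit
  by_cases h1 : z = 1
  · have h2 : algebraMap ℂ 𝔸 z * (a + 1) - (a - 1) = algebraMap ℂ 𝔸 2 := by
      rw [h1, map_one, one_mul, ← one_add_one_eq_two, map_add, map_one]
      abel
    rw [h2]
    exact (IsUnit.mk0 (2 : ℂ) two_ne_zero).map (algebraMap ℂ 𝔸)
  · have hz0 : z - 1 ≠ 0 := sub_ne_zero.2 h1
    have h2 : algebraMap ℂ 𝔸 z * (a + 1) - (a - 1) =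
        algebraMap ℂ 𝔸 (z - 1) * (a + algebraMap ℂ 𝔸 ((z + 1) / (z - 1))) := by
      rw [mul_add (algebraMap ℂ 𝔸 (z - 1)), ← map_mul, mul_div_cancel₀ _ hz0]
      simp only [map_sub, map_add, map_one, mul_add, sub_mul, mul_one, one_mul]
      abel
    rw [h2]
    refine ((IsUnit.mk0 _ hz0).map (algebraMap ℂ 𝔸)).mul (isUnit_add_algebraMap_of_re_pos ha ?_)
    have hsq : 1 ≤ z.re * z.re + z.im * z.im := by
      rw [← Complex.normSq_apply, Complex.normSq_eq_norm_sq]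
      exact one_le_pow₀ hz1
    rw [Complex.div_re, ← add_div]
    refine div_nonneg ?_ (Complex.normSq_nonneg _)
    simp only [Complex.add_re, Complex.one_re, Complex.sub_re, Complex.add_im, Complex.one_im,
      Complex.sub_im]
    linarith

end Cayley

/-! ### Euclidean Lyapunov norms -/

section LyapunovNorm

universe u

variable {X : Type u} [NormedAddCommGroup X] [InnerProductSpace ℂ X] [CompleteSpace X]

/-- An operator whose spectrum lies in the right half plane is expanding for some Euclidean norm. -/
theorem exists_isExpanding_of_spectrum_re_pos {E : Type*} [NormedAddCommGroup E] [NormedSpace ℝ E]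
    {a : X →L[ℂ] X} (ha : ∀ z ∈ spectrum ℂ a, 0 < z.re) {A : E →L[ℝ] E} (J : E →L[ℝ] X)
    (hJ : Function.Injective J) (hJA : ∀ x, J (A x) = a (J x)) :
    ∃ (F : Type u) (_ : NormedAddCommGroup F) (_ : InnerProductSpace ℝ F) (T : E →L[ℝ] F) (c : ℝ),
      Function.Injective T ∧ 0 < c ∧ IsExpanding T c A := by
  let _ : InnerProductSpace ℝ X := InnerProductSpace.complexToReal
  obtain ⟨M, hM, m, hm, hMm⟩ := exists_cayley_norm_pow_lt_one ha
  obtain ⟨u, hu⟩ : IsUnit (a + 1) := by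
    simpa using isUnit_add_algebraMap_of_re_pos ha (w := 1) (by simp)
  -- The vector `(v, M v, …, M^(m-1) v)`. Applying `M` shifts it, so the change in its squared norm
  -- telescopes.
  let T' : X →L[ℝ] PiLp 2 (fun _ : Fin m => X) :=
    (PiLp.continuousLinearEquiv 2 ℝ (fun _ : Fin m => X)).symm.toContinuousLinearMap.comp
      (ContinuousLinearMap.pi fun k : Fin m => (M ^ (k : ℕ)).restrictScalars ℝ)
  have hT' : ∀ v, ‖T' v‖ ^ 2 = ∑ k ∈ Finset.range m, ‖(M ^ k) v‖ ^ 2 := by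
    intro v
    rw [PiLp.norm_sq_eq_of_L2, Finset.sum_range]
    rfl
  have htel : ∀ v, ‖T' (M v)‖ ^ 2 = ‖T' v‖ ^ 2 - ‖v‖ ^ 2 + ‖(M ^ m) v‖ ^ 2 := by
    intro v
    have h1 := Finset.sum_range_succ (fun k => ‖(M ^ k) v‖ ^ 2) m
    have h2 := Finset.sum_range_succ' (fun k => ‖(M ^ k) v‖ ^ 2) m
    have h3 : ∀ k, (M ^ (k + 1)) v = (M ^ k) (M v) := fun k => by rw [pow_succ]; rfl
    simp only [h3] at h2
    rw [hT', hT']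
    simp only [pow_zero, one_apply_eq_self] at h2
    linarith
  have hq : 0 < 1 - ‖M ^ m‖ ^ 2 := by
    have := pow_lt_one₀ (norm_nonneg (M ^ m)) hMm two_ne_zero
    linarith
  -- Put `w = a v + v`, so that `M w = a v - v`. By polarization `‖T' w‖² - ‖T' (M w)‖²` is four
  -- times the inner product, and by telescoping it is `‖w‖² - ‖M^m w‖²`.
  have hpos : ∀ v, (1 - ‖M ^ m‖ ^ 2) * ‖a v + v‖ ^ 2 ≤ 4 * inner ℝ (T' v) (T' (a v)) := by
    intro v
    have h1 := htel (a v + v)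
    have h2 : M (a v + v) = a v - v := by
      have := congrArg (fun L : X →L[ℂ] X => L v) hM
      simpa using this
    rw [h2, map_sub, map_add, @norm_sub_sq_real, @norm_add_sq_real] at h1
    have h3 : ‖(M ^ m) (a v + v)‖ ^ 2 ≤ ‖M ^ m‖ ^ 2 * ‖a v + v‖ ^ 2 := by
      rw [← mul_pow]
      gcongr
      exact (M ^ m).le_opNorm _
    have h4 := real_inner_comm (T' v) (T' (a v))
    linarith
  set Λ : ℝ := ‖T'‖ * ‖(↑u⁻¹ : X →L[ℂ] X)‖ with hΛ
  have hbound : ∀ v, ‖T' v‖ ^ 2 ≤ Λ ^ 2 * ‖a v + v‖ ^ 2 := by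
    intro v
    have h1 : v = (↑u⁻¹ : X →L[ℂ] X) (a v + v) := by
      have := congrArg (fun L : X →L[ℂ] X => L v) u.inv_mul
      rw [hu] at this
      simpa using this.symm
    rw [← mul_pow]
    gcongr
    calc ‖T' v‖ ≤ ‖T'‖ * ‖v‖ := T'.le_opNorm v
      _ ≤ ‖T'‖ * (‖(↑u⁻¹ : X →L[ℂ] X)‖ * ‖a v + v‖) := by
        gcongr
        conv_lhs => rw [h1]
        exact ContinuousLinearMap.le_opNorm _ _
      _ = Λ * ‖a v + v‖ := by rw [hΛ]; ring
  -- The summand `1` in `Λ ^ 2 + 1` keeps the denominator positive even when `Λ = 0`.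
  refine ⟨_, inferInstance, inferInstance, T'.comp J, (1 - ‖M ^ m‖ ^ 2) / (4 * (Λ ^ 2 + 1)), ?_,
    by positivity, fun x => ?_⟩
  · refine Function.Injective.comp (g := T') (fun v w hvw => ?_) hJ
    exact congrArg (fun y : PiLp 2 (fun _ : Fin m => X) => y ⟨0, hm⟩) hvw
  · simp only [ContinuousLinearMap.comp_apply, hJA]
    have h1 := hpos (J x)
    have h2 := hbound (J x)
    rw [div_mul_eq_mul_div, div_le_iff₀ (by positivity)]
    calc (1 - ‖M ^ m‖ ^ 2) * ‖T' (J x)‖ ^ 2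
        ≤ (1 - ‖M ^ m‖ ^ 2) * ((Λ ^ 2 + 1) * ‖a (J x) + J x‖ ^ 2) := by
          gcongr
          nlinarith [sq_nonneg ‖a (J x) + J x‖]
      _ = (Λ ^ 2 + 1) * ((1 - ‖M ^ m‖ ^ 2) * ‖a (J x) + J x‖ ^ 2) := by ring
      _ ≤ (Λ ^ 2 + 1) * (4 * inner ℝ (T' (J x)) (T' (a (J x)))) := by gcongr
      _ = _ := by ring

variable {ι : Type u} [Fintype ι] [DecidableEq ι]

/-- A real matrix whose eigenvalues have positive real parts is expanding for some Euclidean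
norm. -/
theorem Matrix.exists_isExpanding {A : Matrix ι ι ℝ}
    (hA : ∀ z ∈ spectrum ℂ (A.map (algebraMap ℝ ℂ)), 0 < z.re) :
    ∃ (F : Type u) (_ : NormedAddCommGroup F) (_ : InnerProductSpace ℝ F)
      (T : (ι → ℝ) →L[ℝ] F) (c : ℝ),
      Function.Injective T ∧ 0 < c ∧ IsExpanding T c A.mulVecLin.toContinuousLinearMap := by
  let J : (ι → ℝ) →ₗ[ℝ] EuclideanSpace ℂ ι :=
    { toFun := fun x => WithLp.toLp 2 fun i => (x i : ℂ)
      map_add' := fun x y => by ext i; simp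
      map_smul' := fun r x => by ext i; simp }
  refine exists_isExpanding_of_spectrum_re_pos
    (a := Matrix.toEuclideanCLM (𝕜 := ℂ) (A.map (algebraMap ℝ ℂ))) ?_ J.toContinuousLinearMap ?_ ?_
  · rwa [AlgEquiv.spectrum_eq]
  · intro x y hxy
    ext i
    have := congrArg (fun v : EuclideanSpace ℂ ι => v i) hxy
    simpa [J] using this
  · intro x
    ext i
    simp [J, Matrix.mulVec, dotProduct]

end LyapunovNorm

/-! ### A weighted norm for block triangular fields -/

section Gluing

variable {E E₁ E₂ F₁ F₂ : Type*} [NormedAddCommGroup E] [NormedSpace ℝ E]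
  [NormedAddCommGroup E₁] [NormedSpace ℝ E₁] [NormedAddCommGroup E₂] [NormedSpace ℝ E₂]
  [NormedAddCommGroup F₁] [InnerProductSpace ℝ F₁] [NormedAddCommGroup F₂] [InnerProductSpace ℝ F₂]

theorem IsExpanding.mono {T : E →L[ℝ] F₁} {c c' : ℝ} {A : E →L[ℝ] E} (hA : IsExpanding T c A)
    (h : c' ≤ c) : IsExpanding T c' A :=
  fun x => (mul_le_mul_of_nonneg_right h (sq_nonneg _)).trans (hA x)

theorem IsExpanding.id (T : E →L[ℝ] F₁) : IsExpanding T 1 (ContinuousLinearMap.id ℝ E) :=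
  fun x => by simp

/-- The Euclidean norm `√(‖T₁ x₁‖² + r² ‖T₂ x₂‖²)` of a vector with components `x₁`, `x₂`. -/
noncomputable def gluedNorm (P₁ : E →L[ℝ] E₁) (P₂ : E →L[ℝ] E₂) (T₁ : E₁ →L[ℝ] F₁)
    (T₂ : E₂ →L[ℝ] F₂) (r : ℝ) : E →L[ℝ] WithLp 2 (F₁ × F₂) :=
  (WithLp.prodContinuousLinearEquiv 2 ℝ F₁ F₂).symm.toContinuousLinearMap.comp
    ((T₁.comp P₁).prod (r • T₂.comp P₂))

/-- A block triangular vector field with expanding diagonal blocks is expanding. -/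
theorem IsExpanding.gluedNorm {P₁ : E →L[ℝ] E₁} {P₂ : E →L[ℝ] E₂} {T₁ : E₁ →L[ℝ] F₁}
    {T₂ : E₂ →L[ℝ] F₂} {A₁ : E₁ →L[ℝ] E₁} {A₂ : E₂ →L[ℝ] E₂} {L : E₁ →L[ℝ] E₂} {M : E →L[ℝ] E}
    {c K r : ℝ} (h₁ : IsExpanding T₁ c A₁) (h₂ : IsExpanding T₂ c A₂)
    (hL : ∀ x, ‖T₂ (L x)‖ ≤ K * ‖T₁ x‖) (hr : 0 ≤ r) (hrK : r * K ≤ c) (hc : 0 ≤ c)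
    (hM₁ : ∀ x, P₁ (M x) = A₁ (P₁ x)) (hM₂ : ∀ x, P₂ (M x) = L (P₁ x) + A₂ (P₂ x)) :
    IsExpanding (gluedNorm P₁ P₂ T₁ T₂ r) (c / 2) M := by
  intro x
  have hn : ‖_root_.gluedNorm P₁ P₂ T₁ T₂ r x‖ ^ 2 =
      ‖T₁ (P₁ x)‖ ^ 2 + r ^ 2 * ‖T₂ (P₂ x)‖ ^ 2 := by
    rw [WithLp.prod_norm_sq_eq_of_L2]
    simp [_root_.gluedNorm, norm_smul, mul_pow]
  have hi : inner ℝ (_root_.gluedNorm P₁ P₂ T₁ T₂ r x) (_root_.gluedNorm P₁ P₂ T₁ T₂ r (M x)) =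
      inner ℝ (T₁ (P₁ x)) (T₁ (A₁ (P₁ x))) + r ^ 2 * (inner ℝ (T₂ (P₂ x)) (T₂ (L (P₁ x))) +
        inner ℝ (T₂ (P₂ x)) (T₂ (A₂ (P₂ x)))) := by
    rw [WithLp.prod_inner_apply]
    simp [_root_.gluedNorm, hM₁, hM₂, inner_add_right, real_inner_smul_left,
      real_inner_smul_right]
    ring
  rw [hn, hi]
  have k₁ := h₁ (P₁ x)
  have k₂ := h₂ (P₂ x)
  have kL : -(‖T₂ (P₂ x)‖ * (K * ‖T₁ (P₁ x)‖)) ≤ inner ℝ (T₂ (P₂ x)) (T₂ (L (P₁ x))) := by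
    have h := (abs_le.1 (abs_real_inner_le_norm (T₂ (P₂ x)) (T₂ (L (P₁ x))))).1
    have h' := mul_le_mul_of_nonneg_left (hL (P₁ x)) (norm_nonneg (T₂ (P₂ x)))
    linarith
  set α := ‖T₁ (P₁ x)‖ with hα
  set β := ‖T₂ (P₂ x)‖ with hβ
  have hα0 : 0 ≤ α := norm_nonneg _
  have hβ0 : 0 ≤ β := norm_nonneg _
  -- The coupling is quadratic in `r`; one factor is absorbed by `r * K ≤ c`. The
  -- arithmetic–geometric mean inequality then costs half of the rate.
  have e₁ : r ^ 2 * (β * (K * α)) ≤ c * (α * (r * β)) := by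
    have := mul_le_mul_of_nonneg_right hrK (mul_nonneg hα0 (mul_nonneg hr hβ0))
    calc r ^ 2 * (β * (K * α)) = r * K * (α * (r * β)) := by ring
      _ ≤ _ := this
  have e₂ : c * (α * (r * β)) ≤ c / 2 * (α ^ 2 + r ^ 2 * β ^ 2) := by
    have := mul_nonneg hc (sq_nonneg (α - r * β))
    linarith
  have e₃ := mul_le_mul_of_nonneg_left (add_le_add kL k₂) (sq_nonneg r)
  linarith

end Gluing

/-! ### Decoupling the unobserved component -/

section BlockTriangular

variable {ι κ : Type} [Fintype ι] [DecidableEq ι] [Fintype κ] [DecidableEq κ]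

/-- A block triangular linear flow all of whose eigenvalues have positive real parts is conjugate,
by a homeomorphism that preserves the first component, to the flow with the second component
replaced by the uncoupled identity. -/
theorem Matrix.exists_homeomorph_conj_fromBlocks {A₁ : Matrix ι ι ℝ} (L : Matrix κ ι ℝ)
    {A₂ : Matrix κ κ ℝ} (h₁ : ∀ z ∈ spectrum ℂ (A₁.map (algebraMap ℝ ℂ)), 0 < z.re)
    (h₂ : ∀ z ∈ spectrum ℂ (A₂.map (algebraMap ℝ ℂ)), 0 < z.re) :
    ∃ H : (ι ⊕ κ → ℝ) ≃ₜ (ι ⊕ κ → ℝ),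
      (∀ t x, H (linearFlow (fromBlocks A₁ 0 L A₂).mulVecLin.toContinuousLinearMap t x) =
        linearFlow (fromBlocks A₁ 0 0 1).mulVecLin.toContinuousLinearMap t (H x)) ∧
      ∀ x, H x ∘ Sum.inl = x ∘ Sum.inl := by
  obtain ⟨F₁, _, _, T₁, c₁, hT₁, hc₁, hA₁⟩ := exists_isExpanding h₁
  obtain ⟨F₂, _, _, T₂, c₂, hT₂, hc₂, hA₂⟩ := exists_isExpanding h₂
  let P₁ : (ι ⊕ κ → ℝ) →L[ℝ] (ι → ℝ) := (LinearMap.funLeft ℝ ℝ Sum.inl).toContinuousLinearMap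
  let P₂ : (ι ⊕ κ → ℝ) →L[ℝ] (κ → ℝ) := (LinearMap.funLeft ℝ ℝ Sum.inr).toContinuousLinearMap
  let L' : (ι → ℝ) →L[ℝ] (κ → ℝ) := L.mulVecLin.toContinuousLinearMap
  have hanti : ∀ {V W : Type} [NormedAddCommGroup V] [NormedSpace ℝ V] [FiniteDimensional ℝ V]
      [NormedAddCommGroup W] [NormedSpace ℝ W] (T : V →L[ℝ] W), Function.Injective T →
      ∃ K : ℝ, 0 ≤ K ∧ ∀ x, ‖x‖ ≤ K * ‖T x‖ := by
    intro V W _ _ _ _ _ T hT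
    obtain ⟨K, -, hK⟩ := (T : V →ₗ[ℝ] W).exists_antilipschitzWith (LinearMap.ker_eq_bot.2 hT)
    exact ⟨K, K.2, fun x => by simpa using hK.le_mul_dist x 0⟩
  obtain ⟨K₁, hK₁0, hK₁⟩ := hanti T₁ hT₁
  set K : ℝ := ‖T₂.comp L'‖ * K₁ with hK
  have hK0 : 0 ≤ K := by positivity
  have hL : ∀ x, ‖T₂ (L' x)‖ ≤ K * ‖T₁ x‖ := fun x =>
    calc ‖T₂ (L' x)‖ ≤ ‖T₂.comp L'‖ * ‖x‖ := (T₂.comp L').le_opNorm x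
      _ ≤ ‖T₂.comp L'‖ * (K₁ * ‖T₁ x‖) := by gcongr; exact hK₁ x
      _ = K * ‖T₁ x‖ := by rw [hK]; ring
  -- A common rate for the three diagonal blocks `A₁`, `A₂` and the identity, which expands at rate
  -- `1`.
  set c : ℝ := min (min c₁ c₂) 1 with hc
  have hc0 : 0 < c := lt_min (lt_min hc₁ hc₂) one_pos
  have hcc₁ : c ≤ c₁ := (min_le_left _ _).trans (min_le_left _ _)
  have hcc₂ : c ≤ c₂ := (min_le_left _ _).trans (min_le_right _ _)
  have hcc : c ≤ 1 := min_le_right _ _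
  set r : ℝ := c / (K + 1) with hr
  have hr0 : 0 < r := by positivity
  have hrK : r * K ≤ c := by
    rw [hr, div_mul_eq_mul_div, div_le_iff₀ (by positivity)]
    linarith
  have hX := IsExpanding.gluedNorm (P₁ := P₁) (P₂ := P₂)
    (M := (fromBlocks A₁ 0 L A₂).mulVecLin.toContinuousLinearMap)
    (hA₁.mono hcc₁) (hA₂.mono hcc₂) hL hr0.le hrK hc0.le
    (fun x => by ext i; simp [P₁, LinearMap.funLeft, fromBlocks_mulVec])
    (fun x => by ext i; simp [P₁, P₂, L', LinearMap.funLeft, fromBlocks_mulVec])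
  have hY := IsExpanding.gluedNorm (P₁ := P₁) (P₂ := P₂) (L := 0)
    (M := (fromBlocks A₁ 0 0 1).mulVecLin.toContinuousLinearMap)
    (hA₁.mono hcc₁) ((IsExpanding.id T₂).mono hcc) (K := K)
    (fun x => by simpa using mul_nonneg hK0 (norm_nonneg _)) hr0.le hrK hc0.le
    (fun x => by ext i; simp [P₁, LinearMap.funLeft, fromBlocks_mulVec])
    (fun x => by ext i; simp [P₂, LinearMap.funLeft, fromBlocks_mulVec])
  have hinj : Function.Injective (gluedNorm P₁ P₂ T₁ T₂ r) := by
    rw [injective_iff_map_eq_zero]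
    intro x hx
    have e₁ : T₁ (P₁ x) = 0 := congrArg (fun y : WithLp 2 (F₁ × F₂) => y.fst) hx
    have e₂ : r • T₂ (P₂ x) = 0 := congrArg (fun y : WithLp 2 (F₁ × F₂) => y.snd) hx
    rw [smul_eq_zero_iff_right hr0.ne', map_eq_zero_iff T₂ hT₂] at e₂
    rw [map_eq_zero_iff T₁ hT₁] at e₁
    ext (i | i)
    · exact congrFun e₁ i
    · exact congrFun e₂ i
  obtain ⟨K', -, hK'⟩ := hanti _ hinj
  -- Both fields expand the same glued norm and project to `A₁` under `P₁`, so `H` fixes the first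
  -- component.
  obtain ⟨H, hH, hP⟩ := hX.exists_homeomorph_conj hY (half_pos hc0) hK' (P := P₁)
    (D := A₁.mulVecLin.toContinuousLinearMap)
    (fun x => by ext i; simp [P₁, LinearMap.funLeft, fromBlocks_mulVec])
    (fun x => by ext i; simp [P₁, LinearMap.funLeft, fromBlocks_mulVec])
  exact ⟨H, hH, hP⟩

end BlockTriangular

/-! ### Topological normal form of the unobserved components -/

namespace ObsSystem

variable {ι κ : Type} {p : ℕ} [Fintype ι] [DecidableEq ι] [Fintype κ] [DecidableEq κ]

/-- The unobserved component of a system with eigenvalues in the right half plane can be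
replaced by the uncoupled identity. -/
theorem topEquiv_join_one {O : ObsSystem ι p} (L : Matrix κ ι ℝ) {A₂ : Matrix κ κ ℝ}
    (h₁ : ∀ z ∈ spectrum ℂ (O.A.map (algebraMap ℝ ℂ)), 0 < z.re)
    (h₂ : ∀ z ∈ spectrum ℂ (A₂.map (algebraMap ℝ ℂ)), 0 < z.re) :
    TopEquiv (⟨fromBlocks O.A 0 L A₂, fromCols O.C 0⟩ : ObsSystem (ι ⊕ κ) p)
      (O.join (⟨1, 0⟩ : ObsSystem κ p)) := by
  obtain ⟨H, hH, hP⟩ := exists_homeomorph_conj_fromBlocks L h₁ h₂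
  refine topEquiv_of_linearFlow H hH fun x => ?_
  simp [ObsSystem.join, fromCols_mulVec, hP]

theorem forall_mem_spectrum_neg {A : Matrix ι ι ℝ}
    (h : ∀ z ∈ spectrum ℂ (A.map (algebraMap ℝ ℂ)), z.re < 0) :
    ∀ z ∈ spectrum ℂ ((-A).map (algebraMap ℝ ℂ)), 0 < z.re := by
  intro z hz
  have hmap : (-A).map (algebraMap ℝ ℂ) = -(A.map (algebraMap ℝ ℂ)) := by ext; simp
  rw [hmap, ← spectrum.neg_eq, Set.mem_neg] at hz
  simpa using h _ hz

/-- The unobserved component of a system with eigenvalues in the left half plane can be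
replaced by the uncoupled negative identity. -/
theorem topEquiv_join_neg_one {O : ObsSystem ι p} (L : Matrix κ ι ℝ) {A₂ : Matrix κ κ ℝ}
    (h₁ : ∀ z ∈ spectrum ℂ (O.A.map (algebraMap ℝ ℂ)), z.re < 0)
    (h₂ : ∀ z ∈ spectrum ℂ (A₂.map (algebraMap ℝ ℂ)), z.re < 0) :
    TopEquiv (⟨fromBlocks O.A 0 L A₂, fromCols O.C 0⟩ : ObsSystem (ι ⊕ κ) p)
      (O.join (⟨-1, 0⟩ : ObsSystem κ p)) := by
  obtain ⟨H, hH, hP⟩ := exists_homeomorph_conj_fromBlocks (-L) (forall_mem_spectrum_neg h₁)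
    (forall_mem_spectrum_neg h₂)
  refine topEquiv_of_linearFlow H (fun t x => ?_) fun x => ?_
  · have e₁ : (fromBlocks (-O.A) 0 (-L) (-A₂)).mulVecLin.toContinuousLinearMap =
        -(⟨fromBlocks O.A 0 L A₂, fromCols O.C 0⟩ : ObsSystem (ι ⊕ κ) p).field := by
      ext1 x
      have : fromBlocks (-O.A) 0 (-L) (-A₂) = -fromBlocks O.A 0 L A₂ := by
        rw [fromBlocks_neg, neg_zero]
      simp [this]
    have e₂ : (fromBlocks (-O.A) 0 0 (1 : Matrix κ κ ℝ)).mulVecLin.toContinuousLinearMap =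
        -(O.join (⟨-1, 0⟩ : ObsSystem κ p)).field := by
      ext1 x
      have : fromBlocks (-O.A) 0 0 (1 : Matrix κ κ ℝ) = -fromBlocks O.A 0 0 (-1) := by
        rw [fromBlocks_neg, neg_zero, neg_zero, neg_neg]
      simp [this, ObsSystem.join]
    -- The negated fields lie in the expanding case, and a conjugacy of reversed flows conjugates
    -- the original ones.
    have h := hH (-t) x
    rwa [e₁, e₂, linearFlow_neg_left, linearFlow_neg_left, neg_neg] at h
  · simp [ObsSystem.join, fromCols_mulVec, hP]

end ObsSystem

/-! ### Rearranging the blocks -/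

namespace ObsSystem

section Rearrangement

variable {ι ι' κ κ' : Type*} {p : ℕ} [Fintype ι] [Fintype ι'] [Fintype κ] [Fintype κ']

/-- The system `((A, 0; L, U), [C 0])` with state matrix extended by an unobserved component. -/
def extend (S : ObsSystem ι p) (L : Matrix κ ι ℝ) (U : Matrix κ κ ℝ) : ObsSystem (ι ⊕ κ) p :=
  ⟨fromBlocks S.A 0 L U, fromCols S.C 0⟩

/-- Swaps the two middle components, so that the observed parts come first. -/
theorem linEquiv_join_extend (S : ObsSystem ι p) (L : Matrix κ ι ℝ) (U : Matrix κ κ ℝ)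
    (S' : ObsSystem ι' p) (L' : Matrix κ' ι' ℝ) (U' : Matrix κ' κ' ℝ) :
    ((S.extend L U).join (S'.extend L' U')).LinEquiv
      ((S.join S').extend (fromBlocks L 0 0 L') (fromBlocks U 0 0 U')) := by
  have h := linEquiv_reindex ((S.extend L U).join (S'.extend L' U'))
    (Equiv.sumSumSumComm ι κ ι' κ')
  convert h using 1
  ext i j
  · rcases i with (i | i) | (i | i) <;> rcases j with (j | j) | (j | j) <;> rfl
  · rcases j with (j | j) | (j | j) <;> rfl

/-- A linear change of the observed part survives the extension: it conjugates the coupling, while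
the unobserved coordinates are merely renamed. -/
theorem LinEquiv.extend [DecidableEq ι] [DecidableEq κ] [DecidableEq ι'] [DecidableEq κ']
    {S : ObsSystem ι p} {T : ObsSystem ι' p} (h : S.LinEquiv T)
    (e : κ ≃ κ') (L : Matrix κ ι ℝ) (U : Matrix κ κ ℝ) :
    ∃ (L' : Matrix κ' ι' ℝ) (U' : Matrix κ' κ' ℝ), (S.extend L U).LinEquiv (T.extend L' U') := by
  obtain ⟨H, hA, hC⟩ := linEquiv_iff.1 h
  let R : (κ → ℝ) ≃ₗ[ℝ] (κ' → ℝ) := LinearEquiv.funCongrLeft ℝ ℝ e.symm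
  refine ⟨LinearMap.toMatrix' (R.toLinearMap ∘ₗ toLin' L ∘ₗ H.symm.toLinearMap),
    LinearMap.toMatrix' (R.toLinearMap ∘ₗ toLin' U ∘ₗ R.symm.toLinearMap),
    linEquiv_of_intertwine ((LinearEquiv.sumArrowLequivProdArrow _ _ ℝ ℝ).trans
      ((H.prodCongr R).trans (LinearEquiv.sumArrowLequivProdArrow _ _ ℝ ℝ).symm))
      (fun x => ?_) fun x => ?_⟩
  · have hK : ∀ x : ι ⊕ κ → ℝ, ((LinearEquiv.sumArrowLequivProdArrow _ _ ℝ ℝ).trans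
      ((H.prodCongr R).trans (LinearEquiv.sumArrowLequivProdArrow _ _ ℝ ℝ).symm)) x =
        Sum.elim (H (x ∘ Sum.inl)) (R (x ∘ Sum.inr)) := fun x => rfl
    rw [hK, hK, ObsSystem.extend, ObsSystem.extend, fromBlocks_mulVec, fromBlocks_mulVec,
      ← toLin'_apply (LinearMap.toMatrix' _), ← toLin'_apply (LinearMap.toMatrix' _)]
    simp [hA]
  · change (T.extend _ _).C *ᵥ Sum.elim (H (x ∘ Sum.inl)) (R (x ∘ Sum.inr)) = _
    rw [ObsSystem.extend, ObsSystem.extend, fromCols_mulVec, fromCols_mulVec]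
    simp [hC]

end Rearrangement

theorem extend_zero_signSystem {ι : Type*} {p : ℕ} (S : ObsSystem ι p) (a b : ℕ) :
    S.extend 0 (fromBlocks (1 : Matrix (Fin a) (Fin a) ℝ) 0 0
      (-1 : Matrix (Fin b) (Fin b) ℝ)) = S.join (signSystem a b p) := by
  rw [ObsSystem.extend, ObsSystem.join, signSystem, ← fromBlocks_diagonal,
    diagonal_one, ← diagonal_neg, diagonal_one]

end ObsSystem

/-! ### Assembly of the theorem -/

theorem theorem1p3 (n p : ℕ) (A : Matrix (Fin n) (Fin n) ℝ) (C : Matrix (Fin p) (Fin n) ℝ) :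
    Nonempty (ObsSystem.SpectralDecomposition (⟨A, C⟩ : ObsSystem (Fin n) p)) ∧
    ∀ d : ObsSystem.SpectralDecomposition (⟨A, C⟩ : ObsSystem (Fin n) p),
      d.pos.kobs ≤ d.nPos ∧ d.neg.kobs ≤ d.nNeg ∧
      ∀ (R₀ : Set (ObsSystem (Fin d.nZero) p))
        (R₁ : Set (ObsSystem (Fin (d.pos.kobs + d.neg.kobs)) p)),
        ObsSystem.IsLinearCanonicalForm (fun S => S.ZeroRealParts) R₀ →
        ObsSystem.IsLinearCanonicalForm
          (fun S => S.CompletelyObservable ∧ S.NonzeroRealParts) R₁ →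
        ∃ (N : Matrix (Fin d.nZero) (Fin d.nZero) ℝ)
          (K : Matrix (Fin p) (Fin d.nZero) ℝ)
          (B : Matrix (Fin (d.pos.kobs + d.neg.kobs)) (Fin (d.pos.kobs + d.neg.kobs)) ℝ)
          (D : Matrix (Fin p) (Fin (d.pos.kobs + d.neg.kobs)) ℝ),
          (⟨N, K⟩ : ObsSystem _ p) ∈ R₀ ∧ d.zero.LinEquiv ⟨N, K⟩ ∧
          (⟨B, D⟩ : ObsSystem _ p) ∈ R₁ ∧ (d.pos.join d.neg).IsObservablePart ⟨B, D⟩ ∧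
          ObsSystem.TopEquiv ⟨A, C⟩
            (ObsSystem.join ⟨N, K⟩ (ObsSystem.join ⟨B, D⟩
              (ObsSystem.signSystem (d.nPos - d.pos.kobs) (d.nNeg - d.neg.kobs) p))) := by
  refine ⟨ObsSystem.nonempty_spectralDecomposition _, fun d => ?_⟩
  have hkp : d.pos.kobs ≤ d.nPos := by simpa using d.pos.kobs_le_card
  have hkn : d.neg.kobs ≤ d.nNeg := by simpa using d.neg.kobs_le_card
  refine ⟨hkp, hkn, fun R₀ R₁ hR₀ hR₁ => ?_⟩
  obtain ⟨⟨N, K⟩, ⟨hN, hNeq⟩, -⟩ := hR₀.2 d.zero d.zero_re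
  obtain ⟨P, Lp, Up, hPo, hP⟩ := d.pos.exists_kalman_decomposition (m := d.nPos - d.pos.kobs)
    (by rw [Fintype.card_fin]; omega)
  obtain ⟨Q, Lq, Uq, hQo, hQ⟩ := d.neg.exists_kalman_decomposition (m := d.nNeg - d.neg.kobs)
    (by rw [Fintype.card_fin]; omega)
  have hPc := hP.charpoly_eq.trans (charpoly_fromBlocks_zero₁₂ _ _ _)
  have hQc := hQ.charpoly_eq.trans (charpoly_fromBlocks_zero₁₂ _ _ _)
  have hPre := d.pos_re.of_charpoly_dvd (T := P) (hPc ▸ dvd_mul_right _ _)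
  have hUpre := d.pos_re.of_charpoly_dvd (T := ⟨Up, (0 : Matrix (Fin p) _ ℝ)⟩)
    (hPc ▸ dvd_mul_left _ _)
  have hQre := d.neg_re.of_charpoly_dvd (T := Q) (hQc ▸ dvd_mul_right _ _)
  have hUqre := d.neg_re.of_charpoly_dvd (T := ⟨Uq, (0 : Matrix (Fin p) _ ℝ)⟩)
    (hQc ▸ dvd_mul_left _ _)
  have hPQo : (P.join Q).CompletelyObservable :=
    hPo.join hQo (hPre.isCoprime hQre fun z h h' => lt_asymm h h')
  have hPQre : (P.join Q).NonzeroRealParts :=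
    ObsSystem.EigenvaluesSatisfy.join (fun z hz => (hPre z hz).ne') fun z hz => (hQre z hz).ne
  -- The second family is indexed by `Fin` of the sum of the two ranks, not by a sum type.
  have hW := (P.join Q).linEquiv_reindex finSumFinEquiv
  obtain ⟨⟨B, D⟩, ⟨hB, hBeq⟩, -⟩ := hR₁.2 _ ⟨hW.completelyObservable hPQo,
    ObsSystem.EigenvaluesSatisfy.of_charpoly_dvd hPQre hW.charpoly_eq.symm.dvd⟩
  have hPQB := hW.trans hBeq
  refine ⟨N, K, B, D, hN, hNeq, hB, ⟨(hR₁.1 _ hB).1, ?_⟩, ?_⟩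
  -- The observable part is a linear statement, so the original couplings and unobserved blocks are
  -- kept here.
  · obtain ⟨Am, Au, h⟩ := hPQB.extend finSumFinEquiv (fromBlocks Lp 0 0 Lq) (fromBlocks Up 0 0 Uq)
    exact ⟨_, Am, Au, ((hP.join hQ).trans (P.linEquiv_join_extend Lp Up Q Lq Uq)).trans h⟩
  · have hPtop := hP.topEquiv.trans (ObsSystem.topEquiv_join_one Lp hPre hUpre)
    have hQtop := hQ.topEquiv.trans (ObsSystem.topEquiv_join_neg_one Lq hQre hUqre)
    -- The same rearrangement with zero coupling gathers the decoupled blocks `1` and `-1` into the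
    -- sign system.
    have hsplit := P.linEquiv_join_extend 0 1 Q 0 (-1)
      (κ := Fin (d.nPos - d.pos.kobs)) (κ' := Fin (d.nNeg - d.neg.kobs))
    rw [fromBlocks_zero, ObsSystem.extend_zero_signSystem] at hsplit
    exact d.linEquiv.topEquiv.trans (hNeq.topEquiv.join (((hPtop.join hQtop).trans
      hsplit.topEquiv).trans (hPQB.topEquiv.join (ObsSystem.TopEquiv.refl _))))
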